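/- Fix \(\omega\in\mathbb C\) with \(\Im\omega>0\), and set \(q=e^{i\pi\omega}\). Let \[ \theta_1(\lambda|\omega)=-i\sum_{n\in\mathbb Z}(-1)^n q^{(n+\frac12)^2}e^{(2n+1)i\lambda},\quad \theta_2(\lambda|\omega)=\sum_{n\in\mathbb Z} q^{(n+\frac12)^2}e^{(2n+1)i\lambda},\quad \theta_4(\lambda|\omega)=\sum_{n\in\mathbb Z}(-1)^n q^{n^2}e^{2ni\lambda} \] be the usual theta functions, with quasi-periods \(\pi\) and \(\pi\omega\). For \(\eta\in\mathbb C\), the 8-vertex \(R\)-matrix on \(\mathbb C^2\otimes\mathbb C^2\) (basis \(e_1\otimes e_1,\,e_1\otimes e_2,\,e_2\otimes e_1,\,e_2\otimes e_2\)) is \[ R(\lambda)=\begin{pmatrix}\mathsf a(\lambda)&0&0&\mathsf d(\lambda)\\0&\mathsf b(\lambda)&\mathsf c(\lambda)&0\\0&\mathsf c(\lambda)&\mathsf b(\lambda)&0\\\mathsf d(\lambda)&0&0&\mathsf a(\lambda)\end{pmatrix}, \] where, with \(\Delta=\theta_2(0|\omega)\,\theta_4(0|2\omega)\), \[ \mathsf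 a(\lambda)=\tfrac{2}{\Delta}\,\theta_4(\eta|2\omega)\theta_1(\lambda+\eta|2\omega)\theta_4(\lambda|2\omega),\qquad \mathsf b(\lambda)=\tfrac{2}{\Delta}\,\theta_4(\eta|2\omega)\theta_1(\lambda|2\omega)\theta_4(\lambda+\eta|2\omega), \] \[ \mathsf c(\lambda)=\tfrac{2}{\Delta}\,\theta_1(\eta|2\omega)\theta_4(\lambda|2\omega)\theta_4(\lambda+\eta|2\omega),\qquad \mathsf d(\lambda)=\tfrac{2}{\Delta}\,\theta_1(\eta|2\omega)\theta_1(\lambda+\eta|2\omega)\theta_1(\lambda|2\omega). \] Let \(N\ge 0\) be an integer and \(\xi_1,\dots,\xi_N\in\mathbb C\). On \(V_0\otimes V_1\otimes\cdots\otimes V_N\) with all \(V_j=\mathbb C^2\), the monodromy matrix is \[ M(\lambda)=R_{0N}(\lambda-\xi_N)\cdots R_{02}(\lambda-\xi_2)R_{01}(\lambda-\xi_1)=\begin{pmatrix}A(\lambda)&B(\lambda)\\C(\lambda)&D(\lambda)\end{pmatrix}_{[0]}, \] where \(A,B,C,D\) are operators on \(V_1\otimes\cdots\otimes V_N\). For \(x,y\in\{0,1\}\)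 put \(K^{(x,y)}=(\sigma^x)^y(\sigma^z)^x\), where \(\sigma^x,\sigma^z\) are Pauli matrices, and define the twisted transfer matrix \(T_{(x,y)}(\lambda)=\operatorname{tr}_0\big[K^{(x,y)}_0M(\lambda)\big]\). Put \[ \textsc{a}(\lambda)=\prod_{n=1}^N\theta_1(\lambda-\xi_n+\eta|\omega),\qquad \textsc{d}(\lambda)=\textsc{a}(\lambda-\eta), \] and let \(\det_qM(\lambda)=A(\lambda)D(\lambda-\eta)-B(\lambda)C(\lambda-\eta)\) be the quantum determinant. Then for all \(x,y\in\{0,1\}\): 1. For all \(\lambda\in\mathbb C\), \[ T_{(x,y)}(\lambda+\pi)=(-1)^{N+y}\,T_{(x,y)}(\lambda), \] \[ T_{(x,y)}(\lambda+\pi\omega)=\big(-e^{-2i\lambda-i\pi\omega}\big)^N\,e^{2i\left[\sum_{k=1}^N\xi_k-\frac N2\eta+x\frac\pi2\right]}\,T_{(x,y)}(\lambda). \] 2. For every \(n\in\{1,\dots,N\}\), \[ T_{(x,y)}(\xi_n)\,T_{(x,y)}(\xi_n-\eta)=(-1)^{x+y}\,{\det}_qM(\xi_n), \] and, for all \(\lambda\in\mathbb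 C\), \[ {\det}_qM(\lambda)=\textsc{a}(\lambda)\,\textsc{d}(\lambda-\eta)\,\mathrm{Id}=D(\lambda)A(\lambda-\eta)-C(\lambda)B(\lambda-\eta). \] 3. With the operator product taken in the order \(T_{(x,y)}(\xi_1)T_{(x,y)}(\xi_2)\cdots T_{(x,y)}(\xi_N)\), \[ \prod_{n=1}^NT_{(x,y)}(\xi_n)=\prod_{n=1}^N\textsc{a}(\xi_n)\;\prod_{n=1}^NK^{(x,y)}_n, \] where \(K^{(x,y)}_n\) is \(K^{(x,y)}\) acting on \(V_n\). -/

import Mathlib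

open scoped BigOperators

noncomputable section

namespace EightVertex

/-! ## Theta functions with quasi-periods `π` and `π ω` (nome `q = exp (i π ω)`) -/

/-- `θ₁(u | ω) = -i ∑ₙ (-1)ⁿ q^((n + 1/2)²) exp((2n + 1) i u)`, see `hasSum_theta1`. -/
def theta1 (u ω : ℂ) : ℂ :=
  -Complex.I * Complex.exp (Complex.I * u + Complex.I * Real.pi * ω / 4) *
    jacobiTheta₂ (u / Real.pi + 1 / 2 + ω / 2) ω

/-- `θ₂(u | ω) = ∑ₙ q^((n + 1/2)²) exp((2n + 1) i u)`, see `hasSum_theta2`. -/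
def theta2 (u ω : ℂ) : ℂ :=
  Complex.exp (Complex.I * u + Complex.I * Real.pi * ω / 4) *
    jacobiTheta₂ (u / Real.pi + ω / 2) ω

/-- `θ₄(u | ω) = ∑ₙ (-1)ⁿ q^(n²) exp(2 n i u)`, see `hasSum_theta4`. -/
def theta4 (u ω : ℂ) : ℂ :=
  jacobiTheta₂ (u / Real.pi + 1 / 2) ω

theorem exp_int_mul_pi_I (n : ℤ) : Complex.exp (n * (Real.pi * Complex.I)) = (-1) ^ n := by
  rw [Complex.exp_int_mul, Complex.exp_pi_mul_I]

/-- The classical series of `θ₁`. -/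
theorem hasSum_theta1 (u : ℂ) {ω : ℂ} (hω : 0 < ω.im) :
    HasSum (fun n : ℤ => -Complex.I * ((-1) ^ n *
        Complex.exp (Complex.I * Real.pi * ω * ((n : ℂ) + 1 / 2) ^ 2) *
        Complex.exp ((2 * n + 1) * Complex.I * u))) (theta1 u ω) := by
  have hpi : (Real.pi : ℂ) ≠ 0 := by exact_mod_cast Real.pi_ne_zero
  have h := (hasSum_jacobiTheta₂_term (u / Real.pi + 1 / 2 + ω / 2) hω).mul_left
    (-Complex.I * Complex.exp (Complex.I * u + Complex.I * Real.pi * ω / 4))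
  refine Eq.mp (congrArg (fun f => HasSum f _) (funext fun n => ?_)) h
  symm
  rw [jacobiTheta₂_term, ← exp_int_mul_pi_I, mul_assoc (-Complex.I), ← Complex.exp_add,
    ← Complex.exp_add, ← Complex.exp_add]
  congr 2
  field_simp
  ring

/-- The classical series of `θ₂`. -/
theorem hasSum_theta2 (u : ℂ) {ω : ℂ} (hω : 0 < ω.im) :
    HasSum (fun n : ℤ =>
        Complex.exp (Complex.I * Real.pi * ω * ((n : ℂ) + 1 / 2) ^ 2) *
        Complex.exp ((2 * n + 1) * Complex.I * u)) (theta2 u ω) := by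
  have hpi : (Real.pi : ℂ) ≠ 0 := by exact_mod_cast Real.pi_ne_zero
  have h := (hasSum_jacobiTheta₂_term (u / Real.pi + ω / 2) hω).mul_left
    (Complex.exp (Complex.I * u + Complex.I * Real.pi * ω / 4))
  refine Eq.mp (congrArg (fun f => HasSum f _) (funext fun n => ?_)) h
  symm
  rw [jacobiTheta₂_term, ← Complex.exp_add, ← Complex.exp_add]
  congr 1
  field_simp
  ring

/-- The classical series of `θ₄`. -/
theorem hasSum_theta4 (u : ℂ) {ω : ℂ} (hω : 0 < ω.im) :
    HasSum (fun n : ℤ => (-1) ^ n *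
        Complex.exp (Complex.I * Real.pi * ω * (n : ℂ) ^ 2) *
        Complex.exp (2 * n * Complex.I * u)) (theta4 u ω) := by
  have hpi : (Real.pi : ℂ) ≠ 0 := by exact_mod_cast Real.pi_ne_zero
  have h := hasSum_jacobiTheta₂_term (u / Real.pi + 1 / 2) hω
  refine Eq.mp (congrArg (fun f => HasSum f _) (funext fun n => ?_)) h
  symm
  rw [jacobiTheta₂_term, ← exp_int_mul_pi_I, ← Complex.exp_add, ← Complex.exp_add]
  congr 1
  field_simp
  ring

/-! ## The `R`-matrix -/

/-- The common denominator `θ₂(0 | ω) θ₄(0 | 2ω)` of the Boltzmann weights. -/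
def weightDenom (ω : ℂ) : ℂ := theta2 0 ω * theta4 0 (2 * ω)

/-- The weight `a(u)`. -/
def wa (ω η u : ℂ) : ℂ :=
  2 * theta4 η (2 * ω) * theta1 (u + η) (2 * ω) * theta4 u (2 * ω) / weightDenom ω

/-- The weight `b(u)`. -/
def wb (ω η u : ℂ) : ℂ :=
  2 * theta4 η (2 * ω) * theta1 u (2 * ω) * theta4 (u + η) (2 * ω) / weightDenom ω

/-- The weight `c(u)`. -/
def wc (ω η u : ℂ) : ℂ :=
  2 * theta1 η (2 * ω) * theta4 u (2 * ω) * theta4 (u + η) (2 * ω) / weightDenom ω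

/-- The weight `d(u)`. -/
def wd (ω η u : ℂ) : ℂ :=
  2 * theta1 η (2 * ω) * theta1 (u + η) (2 * ω) * theta1 u (2 * ω) / weightDenom ω

/-- The 8-vertex `R`-matrix on `ℂ² ⊗ ℂ²`; `finProdFinEquiv` is the ordering
`(0,0), (0,1), (1,0), (1,1)` of the tensor product basis. -/
def RMatrix (ω η u : ℂ) : Matrix (Fin 2 × Fin 2) (Fin 2 × Fin 2) ℂ :=
  (!![wa ω η u, 0, 0, wd ω η u;
      0, wb ω η u, wc ω η u, 0;
      0, wc ω η u, wb ω η u, 0;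
      wd ω η u, 0, 0, wa ω η u] : Matrix (Fin 4) (Fin 4) ℂ).submatrix
    (fun p : Fin 2 × Fin 2 => finProdFinEquiv p) (fun p : Fin 2 × Fin 2 => finProdFinEquiv p)

/-! ## The quantum space `(ℂ²)^{⊗ N}` and the monodromy matrix -/

/-- `End((ℂ²)^{⊗ N})`, as matrices in the basis `e_{s 0} ⊗ ⋯ ⊗ e_{s (N-1)}`, `s : Fin N → Fin 2`. -/
abbrev QOp (N : ℕ) : Type := Matrix (Fin N → Fin 2) (Fin N → Fin 2) ℂ

/-- The operator `X_n` that acts as `X` on the `n`-th tensor factor and as the identity on the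
others. -/
def siteOp {N : ℕ} (n : Fin N) (X : Matrix (Fin 2) (Fin 2) ℂ) : QOp N :=
  Matrix.of fun s t => X (s n) (t n) * if ∀ m, m ≠ n → s m = t m then 1 else 0

/-- `R_{0n}(u)`, as a `2 × 2` matrix on the auxiliary space with entries in `End((ℂ²)^{⊗ N})`. -/
def R0 {N : ℕ} (ω η : ℂ) (n : Fin N) (u : ℂ) : Matrix (Fin 2) (Fin 2) (QOp N) :=
  Matrix.of fun i j => siteOp n (Matrix.of fun k l => RMatrix ω η u (i, k) (j, l))

/-- The monodromy matrix `R_{0N}(u - ξ_N) ⋯ R_{02}(u - ξ_2) R_{01}(u - ξ_1)`. Its entries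
`0 0`, `0 1`, `1 0`, `1 1` are the operators `A`, `B`, `C`, `D`. -/
def monodromy {N : ℕ} (ω η : ℂ) (ξ : Fin N → ℂ) (u : ℂ) : Matrix (Fin 2) (Fin 2) (QOp N) :=
  (List.ofFn fun n => R0 ω η n (u - ξ n)).reverse.prod

/-- `σˣ`. -/
def sigmaX : Matrix (Fin 2) (Fin 2) ℂ := !![0, 1; 1, 0]

/-- `σᶻ`. -/
def sigmaZ : Matrix (Fin 2) (Fin 2) ℂ := !![1, 0; 0, -1]

/-- The twist matrix `K^{(x,y)} = (σˣ)^y (σᶻ)^x`. -/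
def twist (x y : Fin 2) : Matrix (Fin 2) (Fin 2) ℂ := sigmaX ^ (y : ℕ) * sigmaZ ^ (x : ℕ)

/-- The twisted monodromy matrix `K^{(x,y)} M(u)`, with the twist acting on the auxiliary space. -/
def twistedMonodromy {N : ℕ} (ω η : ℂ) (ξ : Fin N → ℂ) (x y : Fin 2) (u : ℂ) :
    Matrix (Fin 2) (Fin 2) (QOp N) :=
  (twist x y).map (algebraMap ℂ (QOp N)) * monodromy ω η ξ u

/-- The twisted transfer matrix: the trace of `K^{(x,y)} M(u)` over the auxiliary space. -/
def transfer {N : ℕ} (ω η : ℂ) (ξ : Fin N → ℂ) (x y : Fin 2) (u : ℂ) : QOp N :=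
  Matrix.trace (twistedMonodromy ω η ξ x y u)

/-- The quantum determinant `A(u) D(u - η) - B(u) C(u - η)`. -/
def qdet {N : ℕ} (ω η : ℂ) (ξ : Fin N → ℂ) (u : ℂ) : QOp N :=
  monodromy ω η ξ u 0 0 * monodromy ω η ξ (u - η) 1 1 -
    monodromy ω η ξ u 0 1 * monodromy ω η ξ (u - η) 1 0

/-- The function `∏ₙ θ₁(u - ξ_n + η | ω)`. -/
def fa {N : ℕ} (ω η : ℂ) (ξ : Fin N → ℂ) (u : ℂ) : ℂ := ∏ n, theta1 (u - ξ n + η) ω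

/-- The function `u ↦ fa (u - η)`. -/
def fd {N : ℕ} (ω η : ℂ) (ξ : Fin N → ℂ) (u : ℂ) : ℂ := fa ω η ξ (u - η)

end EightVertex

end

open scoped BigOperators

noncomputable section

namespace EightVertex

open Complex

/-! Everything follows from four properties of a single `R`-matrix; the Yang-Baxter equation is not
needed. (a) `R(0) = θ₁(η|ω) P` with `P` the permutation (`blockR_zero`). (b) Unitarity: `R(u) R(-u)`
is the scalar `θ₁(η+u|ω) θ₁(η-u|ω)` (`blockR_mul_blockR_neg`). (c) Crossing: the transformation `Z ↦
σʸ Zᵗ σʸ` of the auxiliary space sends `R(u-η)` to `-R(-u)` (`cross_blockR_sub`). (d) Translation by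
`π` or `πω` conjugates `R` by `σᶻ` or `σˣ` in the auxiliary space, up to a scalar. On the weights,
(b) is the pair of addition formulas `theta4_addition` and `theta1_addition` at modulus `2ω`,
together with the duplication formula that returns to modulus `ω`; the other properties need parity,
half-period shifts and the normalization. Dividing by the denominator requires that the theta
constants do not vanish.

Quasi-periodicity: the conjugations in (d) cancel between neighbouring factors, and conjugating the
twist costs a sign. Quantum determinant: crossing reverses the order of the factors, so `M(u) ·
cross (M(u-η))` collapses to a scalar by unitarity; its two diagonal entries are the two expressions
of the determinant. Inversion: at `ξₙ`, (a) identifies the auxiliary space with site `n`, so that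
`T(ξₙ) = θ₁(η) Rₙ,ₙ₋₁⋯Rₙ,₁ Kₙ Rₙ,N⋯Rₙ,ₙ₊₁`. Crossing gives a matching formula for `T(ξₙ-η)`, and
their product cancels from the inside out, leaving `det K`. Product: multiplying these formulas for
successive `n`, every `Rⱼₙ` meets `Rₙⱼ` and unitarity removes the pair (`list_prod_telescope`). -/

/-- The pairs of integers with even sum, and the pairs with odd sum, each parametrized by `ℤ × ℤ`. -/
def intPairParity : (ℤ × ℤ) ⊕ (ℤ × ℤ) ≃ ℤ × ℤ where
  toFun := Sum.elim (fun p => (p.1 + p.2, p.1 - p.2)) (fun p => (p.1 + p.2 + 1, p.1 - p.2))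
  invFun p := if (p.1 + p.2) % 2 = 0 then Sum.inl ((p.1 + p.2) / 2, (p.1 - p.2) / 2)
    else Sum.inr ((p.1 + p.2) / 2, (p.1 - p.2) / 2)
  left_inv := by
    rintro (⟨k, l⟩ | ⟨k, l⟩)
    · refine (if_pos (show (k + l + (k - l)) % 2 = 0 by omega)).trans
        (congrArg Sum.inl (Prod.ext ?_ ?_))
      · show (k + l + (k - l)) / 2 = k
        omega
      · show (k + l - (k - l)) / 2 = l
        omega
    · refine (if_neg (show ¬ (k + l + 1 + (k - l)) % 2 = 0 by omega)).trans
        (congrArg Sum.inr (Prod.ext ?_ ?_))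
      · show (k + l + 1 + (k - l)) / 2 = k
        omega
      · show (k + l + 1 - (k - l)) / 2 = l
        omega
  right_inv := by
    rintro ⟨n, m⟩
    by_cases h : (n + m) % 2 = 0
    · simp only [h, if_true, Sum.elim_inl, Prod.mk.injEq]
      omega
    · simp only [h, if_false, Sum.elim_inr, Prod.mk.injEq]
      omega

theorem hasSum_mul_of_hasSum {ι κ : Type*} {f : ι → ℂ} {g : κ → ℂ} {a b : ℂ} (hf : HasSum f a)
    (hg : HasSum g b) : HasSum (fun p : ι × κ => f p.1 * g p.2) (a * b) :=
  hf.mul hg (summable_mul_of_summable_norm hf.summable.norm hg.summable.norm)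

theorem hasSum_jacobiTheta₂_term_mul (z w : ℂ) {τ σ : ℂ} (hτ : 0 < τ.im) (hσ : 0 < σ.im) :
    HasSum (fun p : ℤ × ℤ => jacobiTheta₂_term p.1 z τ * jacobiTheta₂_term p.2 w σ)
      (jacobiTheta₂ z τ * jacobiTheta₂ w σ) :=
  hasSum_mul_of_hasSum (f := fun n => jacobiTheta₂_term n z τ)
    (g := fun n => jacobiTheta₂_term n w σ) (hasSum_jacobiTheta₂_term z hτ)
    (hasSum_jacobiTheta₂_term w hσ)

/-- The product formula of two theta functions with the same nome. -/
theorem jacobiTheta₂_mul_jacobiTheta₂ (z w : ℂ) {τ : ℂ} (hτ : 0 < τ.im) :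
    jacobiTheta₂ (z + w) τ * jacobiTheta₂ (z - w) τ =
      jacobiTheta₂ (2 * z) (2 * τ) * jacobiTheta₂ (2 * w) (2 * τ) +
        exp (Real.pi * I * τ + 2 * Real.pi * I * (z + w)) *
          (jacobiTheta₂ (2 * z + τ) (2 * τ) * jacobiTheta₂ (2 * w + τ) (2 * τ)) := by
  have h2 : 0 < (2 * τ).im := by simpa using hτ
  have h := hasSum_jacobiTheta₂_term_mul (z + w) (z - w) hτ hτ
  rw [← intPairParity.hasSum_iff] at h
  refine h.unique (HasSum.sum ?_ ?_)
  · refine (congrArg (HasSum · _) (funext fun p => ?_)).mp (hasSum_jacobiTheta₂_term_mul (2 * z) (2 * w) h2 h2)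
    show _ = jacobiTheta₂_term (p.1 + p.2) _ _ * jacobiTheta₂_term (p.1 - p.2) _ _
    simp only [jacobiTheta₂_term, ← exp_add]
    congr 1
    push_cast
    ring
  · refine (congrArg (HasSum · _) (funext fun p => ?_)).mp
      ((hasSum_jacobiTheta₂_term_mul (2 * z + τ) (2 * w + τ) h2 h2).mul_left _)
    show _ = jacobiTheta₂_term (p.1 + p.2 + 1) _ _ * jacobiTheta₂_term (p.1 - p.2) _ _
    simp only [jacobiTheta₂_term, ← exp_add]
    congr 1
    push_cast
    ring

/-- Since `n` and `n²` have the same parity, the sign `(-1)ⁿ` may be read as `exp (π i n²)` and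
absorbed into `τ`. -/
theorem jacobiTheta₂_half (τ : ℂ) : jacobiTheta₂ (1 / 2) τ = jacobiTheta (τ + 1) := by
  rw [jacobiTheta_eq_jacobiTheta₂, jacobiTheta₂, jacobiTheta₂]
  refine tsum_congr fun n => ?_
  obtain ⟨k, hk⟩ : ∃ k, n - n ^ 2 = 2 * k := by
    obtain ⟨k, hk⟩ := Int.even_mul_succ_self (n - 1)
    exact ⟨-k, by linear_combination -hk⟩
  rw [jacobiTheta₂_term, jacobiTheta₂_term, exp_eq_exp_iff_exists_int]
  have hk' : (n : ℂ) - n ^ 2 = 2 * k := by exact_mod_cast hk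
  exact ⟨k, by linear_combination (Real.pi * I) * hk'⟩

/-- `θ₁` vanishes at `0`. -/
theorem jacobiTheta₂_half_add_half (τ : ℂ) : jacobiTheta₂ (1 / 2 + τ / 2) τ = 0 := by
  -- The point `1/2 + τ/2` and its negative differ by the period `1 + τ`, with multiplier `-1`; by
  -- evenness the value equals its own negative.
  have h := jacobiTheta₂_add_left' (-1 / 2 - τ / 2) τ
  have h1 := jacobiTheta₂_add_left (-1 / 2 + τ / 2) τ
  have h2 := jacobiTheta₂_neg_left (1 / 2 + τ / 2) τ
  rw [show -1 / 2 - τ / 2 + τ = -1 / 2 + τ / 2 by ring, ← h1,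
    show -1 / 2 + τ / 2 + 1 = 1 / 2 + τ / 2 by ring,
    show -1 / 2 - τ / 2 = -(1 / 2 + τ / 2) by ring, h2,
    show -Real.pi * I * (τ + 2 * -(1 / 2 + τ / 2)) = Real.pi * I by ring, exp_pi_mul_I] at h
  linear_combination h / 2

/-! ### Nonvanishing of the theta constants -/

theorem jacobiTheta_mul_jacobiTheta₂_half {τ : ℂ} (hτ : 0 < τ.im) :
    jacobiTheta τ * jacobiTheta₂ (1 / 2) τ = jacobiTheta₂ (1 / 2) (2 * τ) ^ 2 := by
  -- With these arguments the second term of the product formula contains the zero of the theta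
  -- function of modulus `2τ`.
  have h := jacobiTheta₂_mul_jacobiTheta₂ (1 / 4) (-1 / 4) hτ
  have h1 := jacobiTheta₂_half_add_half (2 * τ)
  have h2 := jacobiTheta₂_neg_left (1 / 2) (2 * τ)
  rw [show (1 : ℂ) / 4 + -1 / 4 = 0 by ring, show (1 : ℂ) / 4 - -1 / 4 = 1 / 2 by ring,
    show (2 : ℂ) * (1 / 4) = 1 / 2 by ring, show (2 : ℂ) * (-1 / 4) = -(1 / 2) by ring, h2,
    show (1 : ℂ) / 2 + τ = 1 / 2 + 2 * τ / 2 by ring, h1] at h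
  rw [jacobiTheta_eq_jacobiTheta₂, h]
  ring

theorem jacobiTheta_ne_zero_of_one_le_im {τ : ℂ} (hτ : 1 ≤ τ.im) : jacobiTheta τ ≠ 0 := by
  intro h0
  have h := norm_jacobiTheta_sub_one_le (τ := τ) (by linarith)
  rw [h0, zero_sub, norm_neg, norm_one] at h
  have h3 : Real.exp (-Real.pi * τ.im) ≤ Real.exp (-3) :=
    Real.exp_le_exp.mpr (by nlinarith [Real.pi_gt_three])
  have h4 : Real.exp (-3) < 1 / 4 := by
    rw [Real.exp_neg, inv_eq_one_div, one_div_lt_one_div (Real.exp_pos _) (by norm_num)]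
    linarith [Real.add_one_lt_exp (x := 3) (by norm_num)]
  rw [div_mul_eq_mul_div, le_div_iff₀ (by linarith)] at h
  linarith

/-- By the preceding product identity a zero at `τ` forces one at `2τ + 1`, which doubles the
imaginary part. Finitely many doublings reach `1 ≤ im τ`, where the series is within distance less
than `1` of its constant term. -/
theorem jacobiTheta_ne_zero {τ : ℂ} (hτ : 0 < τ.im) : jacobiTheta τ ≠ 0 := by
  obtain ⟨n, hn⟩ := pow_unbounded_of_one_lt τ.im⁻¹ (one_lt_two (α := ℝ))
  have hn' : 1 ≤ 2 ^ n * τ.im := by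
    rw [inv_lt_iff_one_lt_mul₀ hτ] at hn
    linarith
  clear hn
  induction n generalizing τ with
  | zero => exact jacobiTheta_ne_zero_of_one_le_im (by simpa using hn')
  | succ n ih =>
    intro h0
    have h := jacobiTheta_mul_jacobiTheta₂_half hτ
    rw [h0, zero_mul, jacobiTheta₂_half] at h
    refine ih (τ := 2 * τ + 1) (by simpa using hτ) ?_ (pow_eq_zero_iff two_ne_zero |>.mp h.symm)
    simp only [add_im, mul_im, re_ofNat, im_ofNat, zero_mul, add_zero, one_im]
    rw [pow_succ] at hn'
    linarith

theorem jacobiTheta₂_half_ne_zero {τ : ℂ} (hτ : 0 < τ.im) : jacobiTheta₂ (1 / 2) τ ≠ 0 := by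
  rw [jacobiTheta₂_half]
  exact jacobiTheta_ne_zero (by simpa using hτ)

theorem theta4_zero_ne_zero {ω : ℂ} (hω : 0 < ω.im) : theta4 0 ω ≠ 0 := by
  rw [theta4, zero_div, zero_add]
  exact jacobiTheta₂_half_ne_zero hω

/-- The modular transformation `ω ↦ -1/ω` carries `θ₂(0)` to `θ₄(0)`, up to nonzero factors. -/
theorem theta2_zero_ne_zero {ω : ℂ} (hω : 0 < ω.im) : theta2 0 ω ≠ 0 := by
  have h0 : ω ≠ 0 := by rintro rfl; simp at hω
  have hpi : (Real.pi : ℂ) ≠ 0 := by exact_mod_cast Real.pi_ne_zero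
  rw [theta2, zero_div, zero_add, jacobiTheta₂_functional_equation,
    show ω / 2 / ω = 1 / 2 by field_simp]
  refine mul_ne_zero (exp_ne_zero _) (mul_ne_zero (mul_ne_zero (one_div_ne_zero ?_)
    (exp_ne_zero _)) (jacobiTheta₂_half_ne_zero ?_))
  · rw [Ne, cpow_eq_zero_iff]
    simp [h0]
  · rw [neg_div, one_div, neg_im, inv_im, neg_div, neg_neg]
    exact div_pos hω (normSq_pos.mpr h0)

theorem weightDenom_ne_zero {ω : ℂ} (hω : 0 < ω.im) : weightDenom ω ≠ 0 :=
  mul_ne_zero (theta2_zero_ne_zero hω) (theta4_zero_ne_zero (by simpa using hω))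

/-! ### Periods, parity and duplication of theta functions -/

theorem pi_ne_zero' : (Real.pi : ℂ) ≠ 0 := by exact_mod_cast Real.pi_ne_zero

theorem theta1_add_pi (u ω : ℂ) : theta1 (u + Real.pi) ω = -theta1 u ω := by
  rw [theta1, theta1, show (u + Real.pi) / Real.pi + 1 / 2 + ω / 2 =
      (u / Real.pi + 1 / 2 + ω / 2) + 1 by field_simp [pi_ne_zero']; ring, jacobiTheta₂_add_left,
    show I * (u + Real.pi) + I * Real.pi * ω / 4 =
      (I * u + I * Real.pi * ω / 4) + Real.pi * I by ring, exp_add, exp_pi_mul_I]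
  ring

theorem theta4_add_pi (u ω : ℂ) : theta4 (u + Real.pi) ω = theta4 u ω := by
  rw [theta4, theta4, show (u + Real.pi) / Real.pi + 1 / 2 = (u / Real.pi + 1 / 2) + 1 by
    field_simp [pi_ne_zero']; ring, jacobiTheta₂_add_left]

/-- At modulus `2ω` the shift `πω` is only half a quasi-period, so it exchanges `θ₁` and `θ₄`. This
is why the weights are swapped `a ↔ b`, `c ↔ d`. -/
theorem theta1_add_pi_mul (u ω : ℂ) : theta1 (u + Real.pi * ω) (2 * ω) =
    I * exp (-I * u - I * Real.pi * ω / 2) * theta4 u (2 * ω) := by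
  have h : exp (I * (u + Real.pi * ω) + I * Real.pi * (2 * ω) / 4) *
      exp (-Real.pi * I * (2 * ω + 2 * (u / Real.pi + 1 / 2))) =
      -exp (-I * u - I * Real.pi * ω / 2) := by
    rw [← exp_add, show I * (u + Real.pi * ω) + I * Real.pi * (2 * ω) / 4 +
      -Real.pi * I * (2 * ω + 2 * (u / Real.pi + 1 / 2)) =
      -I * u - I * Real.pi * ω / 2 - Real.pi * I by field_simp [pi_ne_zero']; ring,
      exp_sub _ (Real.pi * I), exp_pi_mul_I]
    ring
  rw [theta1, theta4, show (u + Real.pi * ω) / Real.pi + 1 / 2 + 2 * ω / 2 =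
    (u / Real.pi + 1 / 2) + 2 * ω by field_simp [pi_ne_zero']; ring, jacobiTheta₂_add_left']
  linear_combination (-I * jacobiTheta₂ (u / Real.pi + 1 / 2) (2 * ω)) * h

theorem theta4_add_pi_mul (u ω : ℂ) : theta4 (u + Real.pi * ω) (2 * ω) =
    I * exp (-I * u - I * Real.pi * ω / 2) * theta1 u (2 * ω) := by
  have h : exp (-I * u - I * Real.pi * ω / 2) *
      exp (I * u + I * Real.pi * (2 * ω) / 4) = 1 := by
    rw [← exp_add, exp_eq_one_iff]
    exact ⟨0, by push_cast; ring⟩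
  rw [theta1, theta4, show (u + Real.pi * ω) / Real.pi + 1 / 2 =
    u / Real.pi + 1 / 2 + 2 * ω / 2 by field_simp [pi_ne_zero']; ring]
  linear_combination (-jacobiTheta₂ (u / Real.pi + 1 / 2 + 2 * ω / 2) (2 * ω)) * h +
    (exp (-I * u - I * Real.pi * ω / 2) * exp (I * u + I * Real.pi * (2 * ω) / 4) *
      jacobiTheta₂ (u / Real.pi + 1 / 2 + 2 * ω / 2) (2 * ω)) * I_mul_I

theorem theta4_neg (u ω : ℂ) : theta4 (-u) ω = theta4 u ω := by
  rw [theta4, theta4, show -u / Real.pi + 1 / 2 = -(u / Real.pi + 1 / 2) + 1 by ring,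
    jacobiTheta₂_add_left, jacobiTheta₂_neg_left]

theorem theta1_neg (u ω : ℂ) : theta1 (-u) ω = -theta1 u ω := by
  have h := jacobiTheta₂_add_left' (-u / Real.pi - 1 / 2 - ω / 2) ω
  have h1 := jacobiTheta₂_add_left (-u / Real.pi - 1 / 2 + ω / 2) ω
  have h2 := jacobiTheta₂_neg_left (u / Real.pi + 1 / 2 + ω / 2) ω
  rw [show -u / Real.pi - 1 / 2 - ω / 2 + ω = -u / Real.pi - 1 / 2 + ω / 2 by ring, ← h1,
    show -u / Real.pi - 1 / 2 + ω / 2 + 1 = -u / Real.pi + 1 / 2 + ω / 2 by ring,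
    show -u / Real.pi - 1 / 2 - ω / 2 = -(u / Real.pi + 1 / 2 + ω / 2) by ring, h2] at h
  have h3 : exp (I * -u + I * Real.pi * ω / 4) *
      exp (-Real.pi * I * (ω + 2 * -(u / Real.pi + 1 / 2 + ω / 2))) =
      -exp (I * u + I * Real.pi * ω / 4) := by
    rw [← exp_add, show I * -u + I * Real.pi * ω / 4 +
      -Real.pi * I * (ω + 2 * -(u / Real.pi + 1 / 2 + ω / 2)) =
      I * u + I * Real.pi * ω / 4 + Real.pi * I by field_simp [pi_ne_zero']; ring,
      exp_add _ (Real.pi * I), exp_pi_mul_I]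
    ring
  rw [theta1, theta1, h]
  linear_combination (-I * jacobiTheta₂ (u / Real.pi + 1 / 2 + ω / 2) ω) * h3

theorem theta1_zero (ω : ℂ) : theta1 0 ω = 0 := by
  have h := theta1_neg 0 ω
  rw [neg_zero] at h
  linear_combination h / 2

/-- The duplication formula of the nome. -/
theorem theta1_mul_theta2_zero (x : ℂ) {ω : ℂ} (hω : 0 < ω.im) :
    theta1 x ω * theta2 0 ω = 2 * theta1 x (2 * ω) * theta4 x (2 * ω) := by
  -- The sum and difference of these arguments are those of `θ₁(x|ω)` and `θ₂(0|ω)`. The two terms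
  -- of the product formula then coincide, whence the factor `2`.
  have h := jacobiTheta₂_mul_jacobiTheta₂ (x / Real.pi / 2 + 1 / 4 + ω / 2)
    (x / Real.pi / 2 + 1 / 4) hω
  have h1 := jacobiTheta₂_add_left' (x / Real.pi + 1 / 2) (2 * ω)
  rw [show x / Real.pi / 2 + 1 / 4 + ω / 2 + (x / Real.pi / 2 + 1 / 4) =
      x / Real.pi + 1 / 2 + ω / 2 by ring,
    show x / Real.pi / 2 + 1 / 4 + ω / 2 - (x / Real.pi / 2 + 1 / 4) = ω / 2 by ring,
    show 2 * (x / Real.pi / 2 + 1 / 4 + ω / 2) + ω = x / Real.pi + 1 / 2 + 2 * ω by ring, h1,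
    show 2 * (x / Real.pi / 2 + 1 / 4 + ω / 2) = x / Real.pi + 1 / 2 + ω by ring,
    show 2 * (x / Real.pi / 2 + 1 / 4) = x / Real.pi + 1 / 2 by ring] at h
  have h3 : exp (Real.pi * I * ω + 2 * Real.pi * I * (x / Real.pi + 1 / 2 + ω / 2)) *
      exp (-Real.pi * I * (2 * ω + 2 * (x / Real.pi + 1 / 2))) = 1 := by
    rw [← exp_add, exp_eq_one_iff]
    exact ⟨0, by push_cast; ring⟩
  have h4 : exp (I * x + I * Real.pi * ω / 4) * exp (I * 0 + I * Real.pi * ω / 4) =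
      exp (I * x + I * Real.pi * (2 * ω) / 4) := by
    rw [← exp_add]
    ring_nf
  rw [theta1, theta1, theta2, theta4, zero_div, zero_add, ← h4,
    show x / Real.pi + 1 / 2 + 2 * ω / 2 = x / Real.pi + 1 / 2 + ω by ring]
  linear_combination (-I * (exp (I * x + I * Real.pi * ω / 4) *
    exp (I * 0 + I * Real.pi * ω / 4))) * h + (-I * (exp (I * x + I * Real.pi * ω / 4) *
    exp (I * 0 + I * Real.pi * ω / 4))) * (jacobiTheta₂ (x / Real.pi + 1 / 2) (2 * ω) *
      jacobiTheta₂ (x / Real.pi + 1 / 2 + ω) (2 * ω)) * h3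

/-! ### Addition formulas -/

/-- `θ₃(2u | 2τ)`. -/
def evenPart (τ u : ℂ) : ℂ := jacobiTheta₂ (2 * u / Real.pi) (2 * τ)

/-- `θ₂(2u | 2τ)`. -/
def oddPart (τ u : ℂ) : ℂ :=
  exp (I * Real.pi * τ / 2 + 2 * I * u) * jacobiTheta₂ (2 * u / Real.pi + τ) (2 * τ)

theorem theta4_add_mul_theta4_sub (x y : ℂ) {τ : ℂ} (hτ : 0 < τ.im) :
    theta4 (x + y) τ * theta4 (x - y) τ =
      evenPart τ x * evenPart τ y - oddPart τ x * oddPart τ y := by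
  have h := jacobiTheta₂_mul_jacobiTheta₂ (x / Real.pi + 1 / 2) (y / Real.pi) hτ
  rw [show x / Real.pi + 1 / 2 + y / Real.pi = (x + y) / Real.pi + 1 / 2 by ring,
    show x / Real.pi + 1 / 2 - y / Real.pi = (x - y) / Real.pi + 1 / 2 by ring,
    show 2 * (x / Real.pi + 1 / 2) = 2 * x / Real.pi + 1 by ring,
    show 2 * x / Real.pi + 1 + τ = 2 * x / Real.pi + τ + 1 by ring, jacobiTheta₂_add_left,
    jacobiTheta₂_add_left, show 2 * (y / Real.pi) = 2 * y / Real.pi by ring,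
    show Real.pi * I * τ + 2 * Real.pi * I * ((x + y) / Real.pi + 1 / 2) =
      (I * Real.pi * τ / 2 + 2 * I * x) + (I * Real.pi * τ / 2 + 2 * I * y) + Real.pi * I by
      field_simp [pi_ne_zero']; ring, exp_add _ (Real.pi * I), exp_pi_mul_I, exp_add] at h
  rw [theta4, theta4, h, evenPart, evenPart, oddPart, oddPart]
  ring

theorem theta1_add_mul_theta1_sub (x y : ℂ) {τ : ℂ} (hτ : 0 < τ.im) :
    theta1 (x + y) τ * theta1 (x - y) τ =
      evenPart τ x * oddPart τ y - oddPart τ x * evenPart τ y := by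
  have h := jacobiTheta₂_mul_jacobiTheta₂ (x / Real.pi + 1 / 2 + τ / 2) (y / Real.pi) hτ
  have h1 := jacobiTheta₂_add_left' (2 * x / Real.pi) (2 * τ)
  rw [show x / Real.pi + 1 / 2 + τ / 2 + y / Real.pi = (x + y) / Real.pi + 1 / 2 + τ / 2 by ring,
    show x / Real.pi + 1 / 2 + τ / 2 - y / Real.pi = (x - y) / Real.pi + 1 / 2 + τ / 2 by ring,
    show 2 * (x / Real.pi + 1 / 2 + τ / 2) = 2 * x / Real.pi + τ + 1 by ring,
    show 2 * x / Real.pi + τ + 1 + τ = 2 * x / Real.pi + 2 * τ + 1 by ring, jacobiTheta₂_add_left,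
    jacobiTheta₂_add_left, h1, show 2 * (y / Real.pi) = 2 * y / Real.pi by ring] at h
  have h2 : exp (I * (x + y) + I * Real.pi * τ / 4) * exp (I * (x - y) + I * Real.pi * τ / 4) =
      exp (I * Real.pi * τ / 2 + 2 * I * x) := by
    rw [← exp_add]
    ring_nf
  have h3 : exp (I * Real.pi * τ / 2 + 2 * I * x) *
      (exp (Real.pi * I * τ + 2 * Real.pi * I * ((x + y) / Real.pi + 1 / 2 + τ / 2)) *
        exp (-Real.pi * I * (2 * τ + 2 * (2 * x / Real.pi)))) =
      -exp (I * Real.pi * τ / 2 + 2 * I * y) := by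
    rw [← exp_add, ← exp_add, show -exp (I * Real.pi * τ / 2 + 2 * I * y) =
      exp (I * Real.pi * τ / 2 + 2 * I * y) * exp (Real.pi * I) by rw [exp_pi_mul_I]; ring,
      ← exp_add]
    congr 1
    field_simp [pi_ne_zero']
    ring
  rw [theta1, theta1, evenPart, evenPart, oddPart, oddPart]
  calc _ = (I * I) * (exp (I * (x + y) + I * Real.pi * τ / 4) *
        exp (I * (x - y) + I * Real.pi * τ / 4)) *
        (jacobiTheta₂ ((x + y) / Real.pi + 1 / 2 + τ / 2) τ *
          jacobiTheta₂ ((x - y) / Real.pi + 1 / 2 + τ / 2) τ) := by ring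
    _ = _ := by
      rw [h2, h, I_mul_I]
      linear_combination (-jacobiTheta₂ (2 * x / Real.pi) (2 * τ) *
        jacobiTheta₂ (2 * y / Real.pi + τ) (2 * τ)) * h3

/-- The products `θ₄(x+y)θ₄(x-y)` and `θ₁(x+y)θ₁(x-y)` are bilinear in the vectors (`evenPart`,
`oddPart`) at `x` and `y`. Specializing to `y = 0` expresses all the squares, and a polynomial
identity remains. -/
theorem theta4_addition (x y : ℂ) {τ : ℂ} (hτ : 0 < τ.im) :
    theta4 (x + y) τ * theta4 (x - y) τ * theta4 0 τ ^ 2 =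
      theta4 x τ ^ 2 * theta4 y τ ^ 2 - theta1 x τ ^ 2 * theta1 y τ ^ 2 := by
  have h0 := theta4_add_mul_theta4_sub 0 0 hτ
  have hx := theta4_add_mul_theta4_sub x 0 hτ
  have hy := theta4_add_mul_theta4_sub y 0 hτ
  have kx := theta1_add_mul_theta1_sub x 0 hτ
  have ky := theta1_add_mul_theta1_sub y 0 hτ
  simp only [add_zero, sub_zero, ← pow_two] at h0 hx hy kx ky
  rw [theta4_add_mul_theta4_sub x y hτ, h0, hx, hy, kx, ky]
  ring

theorem theta1_addition (x y : ℂ) {τ : ℂ} (hτ : 0 < τ.im) :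
    theta1 (x + y) τ * theta1 (x - y) τ * theta4 0 τ ^ 2 =
      theta1 x τ ^ 2 * theta4 y τ ^ 2 - theta4 x τ ^ 2 * theta1 y τ ^ 2 := by
  have h0 := theta4_add_mul_theta4_sub 0 0 hτ
  have hx := theta4_add_mul_theta4_sub x 0 hτ
  have hy := theta4_add_mul_theta4_sub y 0 hτ
  have kx := theta1_add_mul_theta1_sub x 0 hτ
  have ky := theta1_add_mul_theta1_sub y 0 hτ
  simp only [add_zero, sub_zero, ← pow_two] at h0 hx hy kx ky
  rw [theta1_add_mul_theta1_sub x y hτ, h0, hx, hy, kx, ky]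
  ring

/-! ### The Boltzmann weights -/

/-- The normalization of the weights is chosen for this: it converts products at modulus `2ω` into
`θ₁` at modulus `ω`. -/
theorem two_mul_theta1_mul_theta4_div (x : ℂ) {ω : ℂ} (hω : 0 < ω.im) :
    2 * theta1 x (2 * ω) * theta4 x (2 * ω) * theta4 0 (2 * ω) / weightDenom ω = theta1 x ω := by
  rw [div_eq_iff (weightDenom_ne_zero hω), weightDenom, ← theta1_mul_theta2_zero x hω]
  ring

theorem wa_zero (η : ℂ) {ω : ℂ} (hω : 0 < ω.im) : wa ω η 0 = theta1 η ω := by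
  rw [wa, zero_add, ← two_mul_theta1_mul_theta4_div η hω]
  ring

theorem wb_zero (ω η : ℂ) : wb ω η 0 = 0 := by
  simp [wb, theta1_zero]

theorem wc_zero (η : ℂ) {ω : ℂ} (hω : 0 < ω.im) : wc ω η 0 = theta1 η ω := by
  rw [wc, zero_add, ← two_mul_theta1_mul_theta4_div η hω]
  ring

theorem wd_zero (ω η : ℂ) : wd ω η 0 = 0 := by
  simp [wd, theta1_zero]

theorem wa_sub (ω η u : ℂ) : wa ω η (u - η) = -wb ω η (-u) := by
  rw [wa, wb, sub_add_cancel, theta1_neg, show -u + η = -(u - η) by ring, theta4_neg]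
  ring

theorem wb_sub (ω η u : ℂ) : wb ω η (u - η) = -wa ω η (-u) := by
  rw [wa, wb, sub_add_cancel, theta4_neg, show -u + η = -(u - η) by ring, theta1_neg]
  ring

theorem wc_sub (ω η u : ℂ) : wc ω η (u - η) = wc ω η (-u) := by
  rw [wc, wc, sub_add_cancel, theta4_neg, show -u + η = -(u - η) by ring, theta4_neg]
  ring

theorem wd_sub (ω η u : ℂ) : wd ω η (u - η) = wd ω η (-u) := by
  rw [wd, wd, sub_add_cancel, theta1_neg, show -u + η = -(u - η) by ring, theta1_neg]
  ring

theorem wa_mul_wa_add (η u : ℂ) {ω : ℂ} (hω : 0 < ω.im) :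
    wa ω η u * wa ω η (-u) + wd ω η u * wd ω η (-u) = theta1 (u + η) ω * theta1 (-u + η) ω := by
  have h := theta4_addition η u (τ := 2 * ω) (by simpa using hω)
  rw [← two_mul_theta1_mul_theta4_div (u + η) hω, ← two_mul_theta1_mul_theta4_div (-u + η) hω,
    wa, wa, wd, wd, theta1_neg, theta4_neg, add_comm u η, show -u + η = η - u by ring]
  linear_combination (-4 * theta1 (η + u) (2 * ω) * theta1 (η - u) (2 * ω) / weightDenom ω ^ 2) * h

theorem wb_mul_wb_add (η u : ℂ) {ω : ℂ} (hω : 0 < ω.im) :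
    wb ω η u * wb ω η (-u) + wc ω η u * wc ω η (-u) = theta1 (u + η) ω * theta1 (-u + η) ω := by
  have h := theta1_addition η u (τ := 2 * ω) (by simpa using hω)
  rw [← two_mul_theta1_mul_theta4_div (u + η) hω, ← two_mul_theta1_mul_theta4_div (-u + η) hω,
    wb, wb, wc, wc, theta1_neg, theta4_neg, add_comm u η, show -u + η = η - u by ring]
  linear_combination (-4 * theta4 (η + u) (2 * ω) * theta4 (η - u) (2 * ω) / weightDenom ω ^ 2) * h

theorem wa_mul_wd_add (ω η u : ℂ) :
    wa ω η u * wd ω η (-u) + wd ω η u * wa ω η (-u) = 0 := by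
  rw [wa, wa, wd, wd, theta1_neg, theta4_neg]
  ring

theorem wb_mul_wc_add (ω η u : ℂ) :
    wb ω η u * wc ω η (-u) + wc ω η u * wb ω η (-u) = 0 := by
  rw [wb, wb, wc, wc, theta1_neg, theta4_neg]
  ring

theorem wa_add_pi (ω η u : ℂ) : wa ω η (u + Real.pi) = -wa ω η u := by
  rw [wa, wa, add_right_comm, theta1_add_pi, theta4_add_pi]
  ring

theorem wb_add_pi (ω η u : ℂ) : wb ω η (u + Real.pi) = -wb ω η u := by
  rw [wb, wb, add_right_comm, theta1_add_pi, theta4_add_pi]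
  ring

theorem wc_add_pi (ω η u : ℂ) : wc ω η (u + Real.pi) = wc ω η u := by
  rw [wc, wc, add_right_comm, theta4_add_pi, theta4_add_pi]

theorem wd_add_pi (ω η u : ℂ) : wd ω η (u + Real.pi) = wd ω η u := by
  rw [wd, wd, add_right_comm, theta1_add_pi, theta1_add_pi]
  ring

/-- The multiplier of the `R`-matrix under the translation by `π ω`. -/
def shiftFactor (ω η u : ℂ) : ℂ := -exp (-2 * I * u - I * Real.pi * ω) * exp (-I * η)

theorem exp_mul_exp_shift (ω η u : ℂ) :
    (I * exp (-I * (u + η) - I * Real.pi * ω / 2)) * (I * exp (-I * u - I * Real.pi * ω / 2)) =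
      shiftFactor ω η u := by
  rw [shiftFactor, neg_mul (exp _), ← exp_add, mul_mul_mul_comm, ← exp_add, I_mul_I, neg_one_mul]
  congr 2
  ring

theorem wa_add_pi_mul (ω η u : ℂ) :
    wa ω η (u + Real.pi * ω) = shiftFactor ω η u * wb ω η u := by
  rw [wa, wb, ← exp_mul_exp_shift, add_right_comm, theta1_add_pi_mul, theta4_add_pi_mul]
  ring

theorem wb_add_pi_mul (ω η u : ℂ) :
    wb ω η (u + Real.pi * ω) = shiftFactor ω η u * wa ω η u := by
  rw [wa, wb, ← exp_mul_exp_shift, add_right_comm, theta1_add_pi_mul, theta4_add_pi_mul]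
  ring

theorem wc_add_pi_mul (ω η u : ℂ) :
    wc ω η (u + Real.pi * ω) = shiftFactor ω η u * wd ω η u := by
  rw [wc, wd, ← exp_mul_exp_shift, add_right_comm, theta4_add_pi_mul, theta4_add_pi_mul]
  ring

theorem wd_add_pi_mul (ω η u : ℂ) :
    wd ω η (u + Real.pi * ω) = shiftFactor ω η u * wc ω η u := by
  rw [wc, wd, ← exp_mul_exp_shift, add_right_comm, theta1_add_pi_mul, theta1_add_pi_mul]
  ring

/-! ### `2 × 2` matrices with noncommuting entries -/

section TwoByTwo

variable {A : Type*} [Ring A]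

/-- Every entry of `Z` commutes with every entry of `W`. -/
def EntriesCommute (Z W : Matrix (Fin 2) (Fin 2) A) : Prop :=
  ∀ i j k l, Commute (Z i j) (W k l)

theorem EntriesCommute.symm {Z W : Matrix (Fin 2) (Fin 2) A} (h : EntriesCommute Z W) :
    EntriesCommute W Z := fun i j k l => (h k l i j).symm

theorem EntriesCommute.mul_right {Z W V : Matrix (Fin 2) (Fin 2) A} (hW : EntriesCommute Z W)
    (hV : EntriesCommute Z V) : EntriesCommute Z (W * V) := fun i j k l => by
  rw [Matrix.mul_apply]
  exact Commute.sum_right _ _ _ fun m _ => (hW i j k m).mul_right (hV i j m l)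

theorem EntriesCommute.mul_left {Z W V : Matrix (Fin 2) (Fin 2) A} (hZ : EntriesCommute Z V)
    (hW : EntriesCommute W V) : EntriesCommute (Z * W) V :=
  (hZ.symm.mul_right hW.symm).symm

theorem EntriesCommute.smul_right [Algebra ℂ A] {Z W : Matrix (Fin 2) (Fin 2) A} (h : EntriesCommute Z W)
    (c : ℂ) : EntriesCommute Z (c • W) := fun i j k l => (h i j k l).smul_right c

theorem EntriesCommute.neg_right {Z W : Matrix (Fin 2) (Fin 2) A} (h : EntriesCommute Z W) :
    EntriesCommute Z (-W) := fun i j k l => (h i j k l).neg_right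

theorem EntriesCommute.map_algebraMap [Algebra ℂ A]
    (Z : Matrix (Fin 2) (Fin 2) A) (K : Matrix (Fin 2) (Fin 2) ℂ) : EntriesCommute Z (K.map (algebraMap ℂ A)) :=
  fun _ _ _ _ => Algebra.commute_algebraMap_right _ _

theorem EntriesCommute.one_right (Z : Matrix (Fin 2) (Fin 2) A) : EntriesCommute Z 1 :=
  fun i j k l => by
    rw [Matrix.one_apply]
    split_ifs
    exacts [Commute.one_right _, Commute.zero_right _]

theorem EntriesCommute.list_prod_right {ι : Type*} {Z : Matrix (Fin 2) (Fin 2) A} (l : List ι)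
    {F : ι → Matrix (Fin 2) (Fin 2) A} (h : ∀ m ∈ l, EntriesCommute Z (F m)) :
    EntriesCommute Z (l.map F).prod := by
  induction l with
  | nil => exact EntriesCommute.one_right Z
  | cons a l ih =>
    rw [List.map_cons, List.prod_cons]
    exact (h a (by simp)).mul_right (ih fun m hm => h m (by simp [hm]))

/-- Over a noncommutative ring the trace is not cyclic in general; commutation between the entries
of the two factors restores this. -/
theorem EntriesCommute.trace_mul_comm {Z W : Matrix (Fin 2) (Fin 2) A} (h : EntriesCommute Z W) :
    Matrix.trace (Z * W) = Matrix.trace (W * Z) := by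
  simp only [Matrix.trace_fin_two, Matrix.mul_apply, Fin.sum_univ_two]
  rw [(h 0 0 0 0).eq, (h 0 1 1 0).eq, (h 1 0 0 1).eq, (h 1 1 1 1).eq]
  abel

/-- The image of `Z` under `Z ↦ σʸ Zᵗ σʸ`. -/
def cross (Z : Matrix (Fin 2) (Fin 2) A) : Matrix (Fin 2) (Fin 2) A :=
  !![Z 1 1, -Z 0 1; -Z 1 0, Z 0 0]

theorem cross_one : cross (1 : Matrix (Fin 2) (Fin 2) A) = 1 := by
  ext i j
  fin_cases i <;> fin_cases j <;> simp [cross]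

theorem EntriesCommute.cross_mul {Z W : Matrix (Fin 2) (Fin 2) A} (h : EntriesCommute Z W) :
    cross (Z * W) = cross W * cross Z := by
  ext i j
  fin_cases i <;> fin_cases j <;>
    simp [cross, Matrix.mul_apply, Fin.sum_univ_two, (h _ _ _ _).eq, add_comm]

variable [Algebra ℂ A]

/-- Crossing preserves the trace, reverses products with scalar matrices, and on scalar `2 × 2`
matrices is the adjugate. -/
theorem trace_mul_eq_trace_cross (K : Matrix (Fin 2) (Fin 2) ℂ) (Z : Matrix (Fin 2) (Fin 2) A) :
    Matrix.trace (K.map (algebraMap ℂ A) * Z) =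
      Matrix.trace (cross Z * K.adjugate.map (algebraMap ℂ A)) := by
  simp only [Matrix.trace_fin_two, Matrix.mul_apply, Fin.sum_univ_two, Matrix.map_apply, cross,
    Matrix.adjugate_fin_two, Matrix.of_apply, Matrix.cons_val', Matrix.cons_val_zero,
    Matrix.cons_val_one, Matrix.cons_val_fin_one, map_neg, mul_neg, neg_mul, neg_neg,
    Algebra.commutes]
  abel

/-- The map `∑ Eᵢⱼ ⊗ Zᵢⱼ ↦ ∑ e(Eᵢⱼ) Zᵢⱼ`, the substitution of the representation `e` for the
auxiliary space. -/
def substAux (e : Matrix (Fin 2) (Fin 2) ℂ →ₐ[ℂ] A) (Z : Matrix (Fin 2) (Fin 2) A) : A :=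
  ∑ i, ∑ j, e (Matrix.single i j 1) * Z i j

/-- The matrix `∑ Eᵢⱼ ⊗ e(Eⱼᵢ)`, the permutation of the two spaces. -/
def permAux (e : Matrix (Fin 2) (Fin 2) ℂ →ₐ[ℂ] A) : Matrix (Fin 2) (Fin 2) A :=
  Matrix.of fun i j => e (Matrix.single j i 1)

/-- This is how a factor `R_{0n}(0)` under the trace turns the auxiliary space into site `n`. -/
theorem trace_permAux_mul (e : Matrix (Fin 2) (Fin 2) ℂ →ₐ[ℂ] A) (Z : Matrix (Fin 2) (Fin 2) A) :
    Matrix.trace (permAux e * Z) = substAux e Z := by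
  simp only [Matrix.trace, Matrix.diag, Matrix.mul_apply, permAux, Matrix.of_apply, substAux]
  rw [Finset.sum_comm]

theorem substAux_map_algebraMap (e : Matrix (Fin 2) (Fin 2) ℂ →ₐ[ℂ] A)
    (K : Matrix (Fin 2) (Fin 2) ℂ) : substAux e (K.map (algebraMap ℂ A)) = e K := by
  conv_rhs => rw [Matrix.matrix_eq_sum_single K]
  simp only [substAux, Matrix.map_apply, map_sum]
  refine Finset.sum_congr rfl fun i _ => Finset.sum_congr rfl fun j _ => ?_
  rw [← Algebra.commutes, ← Algebra.smul_def, ← map_smul, Matrix.smul_single, smul_eq_mul, mul_one]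

theorem substAux_smul_one (e : Matrix (Fin 2) (Fin 2) ℂ →ₐ[ℂ] A) (c : ℂ) :
    substAux e (c • (1 : Matrix (Fin 2) (Fin 2) A)) = c • (1 : A) := by
  have h : (c • (1 : Matrix (Fin 2) (Fin 2) ℂ)).map (algebraMap ℂ A) = c • 1 := by
    ext i j
    fin_cases i <;> fin_cases j <;> simp [Algebra.algebraMap_eq_smul_one]
  rw [← h, substAux_map_algebraMap, map_smul, map_one]

/-- Once the entries of `Z` move past the image of `e`, the product rule of matrix units does the
rest. -/
theorem substAux_mul (e : Matrix (Fin 2) (Fin 2) ℂ →ₐ[ℂ] A) {Z : Matrix (Fin 2) (Fin 2) A}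
    (hZ : EntriesCommute (permAux e) Z) (W : Matrix (Fin 2) (Fin 2) A) :
    substAux e (Z * W) = substAux e Z * substAux e W := by
  have h : ∀ i j k l, Commute (e (Matrix.single i j 1)) (Z k l) := fun i j k l => hZ j i k l
  have h1 : ∀ i j k l, e (Matrix.single i j 1) * Z i j * (e (Matrix.single k l 1) * W k l) =
      (e (Matrix.single i j 1) * e (Matrix.single k l 1)) * (Z i j * W k l) := fun i j k l => by
    rw [mul_assoc, mul_assoc, ← mul_assoc (Z i j), ← (h k l i j).eq, mul_assoc]
  simp only [substAux, Fin.sum_univ_two, Matrix.mul_apply, add_mul, mul_add, h1, ← map_mul,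
    Matrix.single_mul_single_same, mul_one]
  simp
  abel

theorem substAux_list_prod {ι : Type*} (e : Matrix (Fin 2) (Fin 2) ℂ →ₐ[ℂ] A) (l : List ι)
    {F : ι → Matrix (Fin 2) (Fin 2) A} (h : ∀ m ∈ l, EntriesCommute (permAux e) (F m)) :
    substAux e (l.map F).prod = (l.map fun m => substAux e (F m)).prod := by
  induction l with
  | nil =>
    have := substAux_smul_one e 1
    rwa [one_smul, one_smul] at this
  | cons a l ih =>
    rw [List.map_cons, List.prod_cons, List.map_cons, List.prod_cons,
      substAux_mul e (h a (by simp)), ih fun m hm => h m (by simp [hm])]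

end TwoByTwo

/-! ### Ordered products -/

section OrderedProducts

variable {ι A : Type*} [Ring A]

theorem list_prod_map_mul_of_commute (l : List ι) (hl : l.Nodup) {f g : ι → A}
    (h : ∀ i ∈ l, ∀ j ∈ l, i ≠ j → Commute (g i) (f j)) :
    (l.map fun i => f i * g i).prod = (l.map f).prod * (l.map g).prod := by
  induction l with
  | nil => simp
  | cons a l ih =>
    rw [List.nodup_cons] at hl
    have hc : Commute (g a) (l.map f).prod := by
      refine Commute.list_prod_right _ _ fun x hx => ?_
      obtain ⟨j, hj, rfl⟩ := List.mem_map.mp hx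
      exact h a (by simp) j (by simp [hj]) (by rintro rfl; exact hl.1 hj)
    simp only [List.map_cons, List.prod_cons]
    rw [ih hl.2 fun i hi j hj => h i (by simp [hi]) j (by simp [hj]), mul_assoc, mul_assoc,
      ← mul_assoc (g a), hc.eq, mul_assoc]

variable [Algebra ℂ A]

/-- The second product runs backwards, so each `f i` meets its partner `g i` after the pairs between
them have become scalars. -/
theorem list_prod_mul_reverse_prod (l : List ι) {f g : ι → A} {c : ι → ℂ}
    (h : ∀ i ∈ l, f i * g i = c i • 1) :
    (l.map f).prod * (l.reverse.map g).prod = (l.map c).prod • 1 := by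
  induction l with
  | nil => simp
  | cons a l ih =>
    simp only [List.map_cons, List.prod_cons, List.reverse_cons, List.map_append, List.prod_append,
      List.map_nil, List.prod_nil, mul_one]
    rw [mul_assoc, ← mul_assoc _ _ (g a), ih fun i hi => h i (by simp [hi]), smul_mul_assoc, one_mul,
      mul_smul_comm, h a (by simp), smul_smul, mul_comm]

/-- Telescoping of the product of the operators
`T n = tₙₙ rₙ,ₙ₋₁ ⋯ rₙ,₁ kₙ rₙ,ₗ ⋯ rₙ,ₙ₊₁` along an initial segment of a list. -/
theorem list_prod_telescope (l : List ι) (hl : l.Nodup) {T k : ι → A} {r : ι → ι → A}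
    {t : ι → ι → ℂ}
    (hT : ∀ p n s, l = p ++ n :: s →
      T n = t n n • ((p.reverse.map (r n)).prod * k n * (s.reverse.map (r n)).prod))
    (hrr : ∀ i j, i ≠ j → r i j * r j i = (t i j * t j i) • 1)
    (hrk : ∀ i j m, i ≠ j → m ≠ i → m ≠ j → Commute (r i j) (k m))
    (hcomm : ∀ i j m n, i ≠ j → m ≠ n → i ≠ m → i ≠ n → j ≠ m → j ≠ n →
      Commute (r i j) (r m n)) :
    ∀ p s, l = p ++ s → (p.map T).prod = (p.map fun n => (p.map (t n)).prod).prod •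
      ((p.map k).prod * (p.map fun j => (s.reverse.map (r j)).prod).prod) := by
  intro p
  -- After the sites of `p` are processed, only the `r j m` with `j` in `p` and `m` in `s` survive;
  -- appending `n` to `p` must remove the column `m = n`.
  induction p using List.reverseRecOn with
  | nil => simp
  | append_singleton p n ih =>
    intro s hs
    have hs' : l = p ++ n :: s := by simpa using hs
    have hnd : (p ++ n :: s).Nodup := hs' ▸ hl
    rw [List.nodup_append, List.nodup_cons] at hnd
    obtain ⟨hp, ⟨hns, -⟩, hd⟩ := hnd
    have hpn : ∀ i ∈ p, i ≠ n := fun i hi => hd i hi n (by simp)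
    have hps : ∀ i ∈ p, ∀ m ∈ s, i ≠ m := fun i hi m hm => hd i hi m (by simp [hm])
    have hsn : ∀ m ∈ s, n ≠ m := fun m hm => by rintro rfl; exact hns hm
    -- In each row `r j n` is the last factor; these factors are collected at the right end.
    have hQ : (p.map fun j => ((n :: s).reverse.map (r j)).prod).prod =
        (p.map fun j => (s.reverse.map (r j)).prod).prod * (p.map fun j => r j n).prod := by
      rw [← list_prod_map_mul_of_commute p hp]
      · simp
      · intro i hi j hj hij
        refine Commute.list_prod_right _ _ fun x hx => ?_
        obtain ⟨m, hm, rfl⟩ := List.mem_map.mp hx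
        rw [List.mem_reverse] at hm
        exact hcomm i n j m (hpn i hi) (hps j hj m hm) hij (hps i hi m hm) (hpn j hj).symm
          (hsn m hm)
    have hk : Commute (p.map fun j => (s.reverse.map (r j)).prod).prod (k n) := by
      refine Commute.list_prod_left _ _ fun x hx => ?_
      obtain ⟨j, hj, rfl⟩ := List.mem_map.mp hx
      refine Commute.list_prod_left _ _ fun x hx => ?_
      obtain ⟨m, hm, rfl⟩ := List.mem_map.mp hx
      rw [List.mem_reverse] at hm
      exact hrk j m n (hps j hj m hm) (hpn j hj).symm (hsn m hm)
    -- The collected column meets the initial factors of `T n` in the opposite order and cancels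
    -- against them.
    have hR := list_prod_mul_reverse_prod p (f := fun j => r j n) (g := r n)
      (c := fun j => t j n * t n j) fun i hi => hrr i n (hpn i hi)
    simp only [List.map_append, List.map_cons, List.map_nil, List.prod_append, List.prod_cons,
      List.prod_nil, mul_one]
    rw [ih (n :: s) hs', hT p n s hs', hQ]
    simp only [List.prod_map_mul] at hR ⊢
    set S := (p.map fun j => (s.reverse.map (r j)).prod).prod
    set U := (p.map fun j => r j n).prod
    set V := (p.reverse.map (r n)).prod
    set W := (s.reverse.map (r n)).prod
    set P := (p.map k).prod
    have hmain : P * (S * U) * (V * k n * W) =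
        ((p.map fun j => t j n).prod * (p.map fun j => t n j).prod) • (P * k n * (S * W)) := by
      calc P * (S * U) * (V * k n * W) = P * S * (U * V) * (k n * W) := by noncomm_ring
        _ = _ • (P * (S * k n) * W) := by
          rw [hR, mul_smul_comm, mul_one, smul_mul_assoc]
          noncomm_ring
        _ = _ := by
          rw [hk.eq]
          noncomm_ring
    rw [smul_mul_smul_comm, hmain, smul_smul]
    congr 1
    ring

end OrderedProducts

/-! ### Operators at a site -/

theorem siteOp_mul_apply {N : ℕ} (n : Fin N) (X : Matrix (Fin 2) (Fin 2) ℂ) (Z : QOp N)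
    (s t : Fin N → Fin 2) :
    (siteOp n X * Z) s t = ∑ a, X (s n) a * Z (Function.update s n a) t := by
  rw [Matrix.mul_apply]
  have hinj : Function.Injective fun a => Function.update s n a := Function.update_injective s n
  have h := Finset.sum_image (s := Finset.univ) (f := fun r => X (s n) (r n) * Z r t)
    fun a _ b _ h => hinj h
  simp only [Function.update_self] at h
  rw [← h]
  symm
  -- Only configurations that differ from `s` at most at `n` contribute.
  refine Finset.sum_subset_zero_on_sdiff (Finset.subset_univ _) ?_ ?_
  · intro r hr
    rw [siteOp, Matrix.of_apply, if_neg, mul_zero, zero_mul]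
    intro h
    refine (Finset.mem_sdiff.mp hr).2 (Finset.mem_image.mpr ⟨r n, Finset.mem_univ _, ?_⟩)
    ext m
    by_cases hm : m = n
    · subst hm; simp
    · simp [hm, h m hm]
  · intro r hr
    obtain ⟨a, -, rfl⟩ := Finset.mem_image.mp hr
    rw [siteOp, Matrix.of_apply, if_pos, mul_one]
    intro m hm
    simp [hm]

theorem siteOp_mul {N : ℕ} (n : Fin N) (X Y : Matrix (Fin 2) (Fin 2) ℂ) :
    siteOp n (X * Y) = siteOp n X * siteOp n Y := by
  ext s t
  rw [siteOp_mul_apply]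
  have h : ∀ a, (∀ m, m ≠ n → Function.update s n a m = t m) ↔ ∀ m, m ≠ n → s m = t m :=
    fun a => forall₂_congr fun m hm => by rw [Function.update_of_ne hm]
  simp only [siteOp, Matrix.of_apply, h, Function.update_self, Matrix.mul_apply, Finset.sum_mul,
    mul_assoc]

theorem siteOp_one {N : ℕ} (n : Fin N) : siteOp n 1 = 1 := by
  ext s t
  rw [siteOp, Matrix.of_apply, Matrix.one_apply, Matrix.one_apply]
  by_cases h : s = t
  · subst h; simp
  · rw [if_neg h]
    by_cases h1 : s n = t n
    · rw [if_pos h1, one_mul, if_neg fun h2 => h (funext fun m => ?_)]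
      by_cases hm : m = n
      · rw [hm, h1]
      · exact h2 m hm
    · rw [if_neg h1, zero_mul]

/-- `siteOp n` as a homomorphism of algebras. -/
def siteHom {N : ℕ} (n : Fin N) : Matrix (Fin 2) (Fin 2) ℂ →ₐ[ℂ] QOp N :=
  AlgHom.ofLinearMap
    { toFun := siteOp n
      map_add' := fun X Y => by
        ext s t
        simp only [siteOp, Matrix.of_apply, Matrix.add_apply, add_mul]
      map_smul' := fun c X => by ext s t; simp [siteOp] }
    (siteOp_one n) (siteOp_mul n)

theorem siteHom_apply {N : ℕ} (n : Fin N) (X : Matrix (Fin 2) (Fin 2) ℂ) :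
    siteHom n X = siteOp n X := rfl

theorem siteOp_mul_siteOp_apply {N : ℕ} {n m : Fin N} (h : n ≠ m)
    (X Y : Matrix (Fin 2) (Fin 2) ℂ) (s t : Fin N → Fin 2) :
    (siteOp n X * siteOp m Y) s t = X (s n) (t n) * Y (s m) (t m) *
      if ∀ k, k ≠ n → k ≠ m → s k = t k then 1 else 0 := by
  rw [siteOp_mul_apply, Finset.sum_eq_single (t n)]
  · rw [siteOp, Matrix.of_apply, Function.update_of_ne h.symm, ← mul_assoc]
    congr 2
    refine propext ⟨fun hk k hn hm => ?_, fun hk k hm => ?_⟩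
    · rw [← hk k hm, Function.update_of_ne hn]
    · by_cases hn : k = n
      · rw [hn, Function.update_self]
      · rw [Function.update_of_ne hn, hk k hn hm]
  · intro a _ ha
    rw [siteOp, Matrix.of_apply, if_neg, mul_zero, mul_zero]
    intro hk
    exact ha (by simpa using hk n h)
  · simp

theorem siteHom_commute {N : ℕ} {n m : Fin N} (h : n ≠ m) (X Y : Matrix (Fin 2) (Fin 2) ℂ) :
    Commute (siteHom n X) (siteHom m Y) := by
  ext s t
  rw [siteHom_apply, siteHom_apply, siteOp_mul_siteOp_apply h, siteOp_mul_siteOp_apply h.symm,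
    mul_comm (X _ _)]
  congr 2
  exact propext ⟨fun hk k hm hn => hk k hn hm, fun hk k hn hm => hk k hm hn⟩

/-! ### The `R`-matrix as a block matrix -/

/-- The `R`-matrix as a `2 × 2` matrix with entries in the operators on the second factor. -/
def blockR (ω η u : ℂ) : Matrix (Fin 2) (Fin 2) (Matrix (Fin 2) (Fin 2) ℂ) :=
  !![!![wa ω η u, 0; 0, wb ω η u], !![0, wd ω η u; wc ω η u, 0];
    !![0, wc ω η u; wd ω η u, 0], !![wb ω η u, 0; 0, wa ω η u]]

theorem R0_eq_map {N : ℕ} (ω η : ℂ) (n : Fin N) (u : ℂ) :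
    R0 ω η n u = (blockR ω η u).map (siteHom n) := by
  ext i j : 1
  rw [R0, Matrix.of_apply, Matrix.map_apply, siteHom_apply]
  congr 1
  ext k l
  fin_cases i <;> fin_cases j <;> fin_cases k <;> fin_cases l <;>
    simp [RMatrix, blockR, finProdFinEquiv]

theorem blockR_mul_blockR_neg (η u : ℂ) {ω : ℂ} (hω : 0 < ω.im) :
    blockR ω η u * blockR ω η (-u) =
      (theta1 (u + η) ω * theta1 (-u + η) ω) • (1 : Matrix (Fin 2) (Fin 2) _) := by
  have h1 := wa_mul_wa_add η u hω
  have h2 := wb_mul_wb_add η u hω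
  have h3 := wa_mul_wd_add ω η u
  have h4 := wb_mul_wc_add ω η u
  ext i j k l
  fin_cases i <;> fin_cases j <;> fin_cases k <;> fin_cases l <;>
    simp [blockR, Matrix.mul_apply, Fin.sum_univ_two] <;>
    first
      | linear_combination h1
      | linear_combination h2
      | linear_combination h3
      | linear_combination h4

theorem cross_blockR_sub (ω η u : ℂ) : cross (blockR ω η (u - η)) = -blockR ω η (-u) := by
  ext i j k l
  fin_cases i <;> fin_cases j <;> fin_cases k <;> fin_cases l <;>
    simp [blockR, cross, wa_sub, wb_sub, wc_sub, wd_sub]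

theorem blockR_zero (η : ℂ) {ω : ℂ} (hω : 0 < ω.im) :
    blockR ω η 0 = theta1 η ω • permAux (AlgHom.id ℂ (Matrix (Fin 2) (Fin 2) ℂ)) := by
  ext i j k l
  fin_cases i <;> fin_cases j <;> fin_cases k <;> fin_cases l <;>
    simp [blockR, permAux, wa_zero η hω, wb_zero, wc_zero η hω, wd_zero]

theorem blockR_add_pi (ω η u : ℂ) : blockR ω η (u + Real.pi) =
    -(sigmaZ.map (algebraMap ℂ _) * blockR ω η u * sigmaZ.map (algebraMap ℂ _)) := by
  ext i j k l
  fin_cases i <;> fin_cases j <;> fin_cases k <;> fin_cases l <;>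
    simp [blockR, sigmaZ, Matrix.mul_apply, Fin.sum_univ_two, wa_add_pi, wb_add_pi, wc_add_pi,
      wd_add_pi]

theorem blockR_add_pi_mul (ω η u : ℂ) : blockR ω η (u + Real.pi * ω) =
    shiftFactor ω η u •
      (sigmaX.map (algebraMap ℂ _) * blockR ω η u * sigmaX.map (algebraMap ℂ _)) := by
  ext i j k l
  fin_cases i <;> fin_cases j <;> fin_cases k <;> fin_cases l <;>
    simp [blockR, sigmaX, Matrix.mul_apply, Fin.sum_univ_two, wa_add_pi_mul, wb_add_pi_mul,
      wc_add_pi_mul, wd_add_pi_mul]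

section Map

variable {A B : Type*} [Ring A] [Algebra ℂ A] [Ring B] [Algebra ℂ B] (e : A →ₐ[ℂ] B)

theorem map_smul_one_algHom (c : ℂ) :
    (c • (1 : Matrix (Fin 2) (Fin 2) A)).map e = c • 1 := by
  ext i j
  fin_cases i <;> fin_cases j <;> simp

theorem map_map_algebraMap (K : Matrix (Fin 2) (Fin 2) ℂ) :
    (K.map (algebraMap ℂ A)).map e = K.map (algebraMap ℂ B) := by
  ext i j
  simp

theorem cross_map (Z : Matrix (Fin 2) (Fin 2) A) : cross (Z.map e) = (cross Z).map e := by
  ext i j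
  fin_cases i <;> fin_cases j <;> simp [cross]

end Map

/-! ### The `R`-matrix acting at sites -/

section Sites

variable {N : ℕ}

theorem R0_mul_R0_neg (η : ℂ) (n : Fin N) (u : ℂ) {ω : ℂ} (hω : 0 < ω.im) :
    R0 ω η n u * R0 ω η n (-u) = (theta1 (u + η) ω * theta1 (-u + η) ω) • 1 := by
  rw [R0_eq_map, R0_eq_map, ← Matrix.map_mul, blockR_mul_blockR_neg η u hω, map_smul_one_algHom]

theorem cross_R0_sub (ω η : ℂ) (n : Fin N) (u : ℂ) :
    cross (R0 ω η n (u - η)) = -R0 ω η n (-u) := by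
  rw [R0_eq_map, R0_eq_map, cross_map, cross_blockR_sub]
  ext i j : 1
  simp

theorem R0_zero (η : ℂ) (n : Fin N) {ω : ℂ} (hω : 0 < ω.im) :
    R0 ω η n 0 = theta1 η ω • permAux (siteHom n) := by
  rw [R0_eq_map, blockR_zero η hω]
  ext i j : 1
  exact map_smul (siteHom n) _ _

theorem R0_add_pi (ω η : ℂ) (n : Fin N) (u : ℂ) : R0 ω η n (u + Real.pi) =
    -(sigmaZ.map (algebraMap ℂ _) * R0 ω η n u * sigmaZ.map (algebraMap ℂ _)) := by
  rw [R0_eq_map, R0_eq_map, blockR_add_pi, ← map_map_algebraMap (siteHom n), ← Matrix.map_mul,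
    ← Matrix.map_mul]
  ext i j : 1
  exact map_neg (siteHom n) _

theorem R0_add_pi_mul (ω η : ℂ) (n : Fin N) (u : ℂ) : R0 ω η n (u + Real.pi * ω) =
    shiftFactor ω η u •
      (sigmaX.map (algebraMap ℂ _) * R0 ω η n u * sigmaX.map (algebraMap ℂ _)) := by
  rw [R0_eq_map, R0_eq_map, blockR_add_pi_mul, ← map_map_algebraMap (siteHom n), ← Matrix.map_mul,
    ← Matrix.map_mul]
  ext i j : 1
  exact map_smul (siteHom n) _ _

theorem entriesCommute_R0 (ω η : ℂ) {n m : Fin N} (h : n ≠ m) (u v : ℂ) :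
    EntriesCommute (R0 ω η n u) (R0 ω η m v) := fun i j k l => by
  rw [R0_eq_map, R0_eq_map]
  exact siteHom_commute h _ _

theorem entriesCommute_permAux_R0 (ω η : ℂ) {n m : Fin N} (h : n ≠ m) (v : ℂ) :
    EntriesCommute (permAux (siteHom n)) (R0 ω η m v) := fun i j k l => by
  rw [R0_eq_map]
  exact siteHom_commute h _ _

/-- The operator `R_{nm}(u)` on the quantum space. -/
def siteR (ω η : ℂ) (n m : Fin N) (u : ℂ) : QOp N := substAux (siteHom n) (R0 ω η m u)

theorem siteR_eq (ω η : ℂ) (n m : Fin N) (u : ℂ) : siteR ω η n m u =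
    ∑ i, ∑ j, siteHom n (Matrix.single i j 1) * siteHom m (blockR ω η u i j) := by
  rw [siteR, substAux, R0_eq_map]
  rfl

/-- The `R`-matrix is invariant under exchange of its two spaces: its expansion in pairs of matrix
units is symmetric. -/
theorem siteR_comm (ω η : ℂ) {n m : Fin N} (h : n ≠ m) (u : ℂ) :
    siteR ω η n m u = siteR ω η m n u := by
  have h00 : blockR ω η u 0 0 =
      wa ω η u • Matrix.single 0 0 1 + wb ω η u • Matrix.single 1 1 1 := by
    ext k l; fin_cases k <;> fin_cases l <;> simp [blockR]
  have h01 : blockR ω η u 0 1 =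
      wd ω η u • Matrix.single 0 1 1 + wc ω η u • Matrix.single 1 0 1 := by
    ext k l; fin_cases k <;> fin_cases l <;> simp [blockR]
  have h10 : blockR ω η u 1 0 =
      wc ω η u • Matrix.single 0 1 1 + wd ω η u • Matrix.single 1 0 1 := by
    ext k l; fin_cases k <;> fin_cases l <;> simp [blockR]
  have h11 : blockR ω η u 1 1 =
      wb ω η u • Matrix.single 0 0 1 + wa ω η u • Matrix.single 1 1 1 := by
    ext k l; fin_cases k <;> fin_cases l <;> simp [blockR]
  have hc : ∀ X Y, siteHom m X * siteHom n Y = siteHom n Y * siteHom m X :=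
    fun X Y => (siteHom_commute h Y X).symm.eq
  simp only [siteR_eq, Fin.sum_univ_two, h00, h01, h10, h11, map_add, map_smul, mul_add, add_mul,
    mul_smul_comm, smul_mul_assoc, hc]
  abel

theorem siteR_mul_siteR_neg (η : ℂ) {n m : Fin N} (h : n ≠ m) (u : ℂ) {ω : ℂ} (hω : 0 < ω.im) :
    siteR ω η n m u * siteR ω η m n (-u) = (theta1 (u + η) ω * theta1 (-u + η) ω) • 1 := by
  rw [siteR_comm ω η h.symm, siteR, siteR, ← substAux_mul _ (entriesCommute_permAux_R0 ω η h u),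
    R0_mul_R0_neg η m u hω, substAux_smul_one]

theorem siteR_commute_siteHom (ω η : ℂ) {n m k : Fin N} (hn : k ≠ n) (hm : k ≠ m) (u : ℂ)
    (X : Matrix (Fin 2) (Fin 2) ℂ) : Commute (siteR ω η n m u) (siteHom k X) := by
  rw [siteR_eq]
  exact Commute.sum_left _ _ _ fun i _ => Commute.sum_left _ _ _ fun j _ =>
    (siteHom_commute hn.symm _ _).mul_left (siteHom_commute hm.symm _ _)

theorem siteR_commute_siteR (ω η : ℂ) {n m k l : Fin N} (hnk : n ≠ k) (hnl : n ≠ l) (hmk : m ≠ k)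
    (hml : m ≠ l) (u v : ℂ) : Commute (siteR ω η n m u) (siteR ω η k l v) := by
  rw [siteR_eq ω η k l]
  exact Commute.sum_right _ _ _ fun i _ => Commute.sum_right _ _ _ fun j _ =>
    (siteR_commute_siteHom ω η hnk.symm hmk.symm _ _).mul_right
      (siteR_commute_siteHom ω η hnl.symm hml.symm _ _)

end Sites

/-! ### The twist -/

/-- Each Pauli factor has determinant `-1`; this is the sign of the inversion identity. -/
theorem twist_mul_adjugate (x y : Fin 2) :
    twist x y * (twist x y).adjugate = ((-1 : ℂ) ^ ((x : ℕ) + (y : ℕ))) • 1 := by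
  rw [Matrix.mul_adjugate]
  congr 1
  simp [twist, sigmaX, sigmaZ, Matrix.det_fin_two, pow_add, mul_comm]

theorem sigmaZ_mul_sigmaZ : sigmaZ * sigmaZ = 1 := by
  ext i j
  fin_cases i <;> fin_cases j <;> simp [sigmaZ]

theorem sigmaX_mul_sigmaX : sigmaX * sigmaX = 1 := by
  ext i j
  fin_cases i <;> fin_cases j <;> simp [sigmaX]

theorem sigmaZ_conj_twist (x y : Fin 2) :
    sigmaZ * twist x y * sigmaZ = ((-1 : ℂ) ^ (y : ℕ)) • twist x y := by
  ext i j
  fin_cases x <;> fin_cases y <;> fin_cases i <;> fin_cases j <;> simp [twist, sigmaX, sigmaZ]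

theorem sigmaX_conj_twist (x y : Fin 2) :
    sigmaX * twist x y * sigmaX = ((-1 : ℂ) ^ (x : ℕ)) • twist x y := by
  ext i j
  fin_cases x <;> fin_cases y <;> fin_cases i <;> fin_cases j <;> simp [twist, sigmaX, sigmaZ]

section Conjugation

variable {A : Type*} [Ring A] [Algebra ℂ A]

theorem map_algebraMap_mul (K L : Matrix (Fin 2) (Fin 2) ℂ) :
    (K * L).map (algebraMap ℂ A) = K.map (algebraMap ℂ A) * L.map (algebraMap ℂ A) :=
  Matrix.map_mul

theorem map_algebraMap_one :
    (1 : Matrix (Fin 2) (Fin 2) ℂ).map (algebraMap ℂ A) = 1 :=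
  Matrix.map_one _ (map_zero _) (map_one _)

theorem map_algebraMap_smul (c : ℂ) (K : Matrix (Fin 2) (Fin 2) ℂ) :
    (c • K).map (algebraMap ℂ A) = c • K.map (algebraMap ℂ A) := by
  ext i j
  rw [Matrix.map_apply, Matrix.smul_apply, Matrix.smul_apply, Matrix.map_apply, smul_eq_mul, map_mul,
    Algebra.smul_def]

theorem list_prod_conj {ι : Type*} (l : List ι) {S : Matrix (Fin 2) (Fin 2) ℂ} (hS : S * S = 1)
    (c : ι → ℂ) (F : ι → Matrix (Fin 2) (Fin 2) A) :
    (l.map fun m => c m • (S.map (algebraMap ℂ A) * F m * S.map (algebraMap ℂ A))).prod =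
      (l.map c).prod • (S.map (algebraMap ℂ A) * (l.map F).prod * S.map (algebraMap ℂ A)) := by
  have hS' : S.map (algebraMap ℂ A) * S.map (algebraMap ℂ A) = 1 := by
    rw [← map_algebraMap_mul, hS, map_algebraMap_one]
  induction l with
  | nil => simp [hS']
  | cons a l ih =>
    simp only [List.map_cons, List.prod_cons]
    rw [ih, smul_mul_smul_comm]
    congr 1
    rw [mul_assoc _ _ (S.map _), mul_assoc _ _ (S.map _), mul_assoc, mul_assoc (F a),
      ← mul_assoc (S.map _) (S.map _), hS', one_mul]
    simp only [mul_assoc]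

theorem trace_conj {S K : Matrix (Fin 2) (Fin 2) ℂ} {c : ℂ} (h : S * K * S = c • K)
    (Z : Matrix (Fin 2) (Fin 2) A) :
    Matrix.trace (K.map (algebraMap ℂ A) *
        (S.map (algebraMap ℂ A) * Z * S.map (algebraMap ℂ A))) =
      c • Matrix.trace (K.map (algebraMap ℂ A) * Z) := by
  rw [← mul_assoc, ((EntriesCommute.map_algebraMap _ S)).trace_mul_comm, ← mul_assoc,
    ← mul_assoc, ← map_algebraMap_mul, ← map_algebraMap_mul, h, map_algebraMap_smul,
    smul_mul_assoc, Matrix.trace_smul]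

end Conjugation

/-! ### The monodromy matrix -/

section Monodromy

variable {N : ℕ}

/-- The partial monodromy matrix, the product of the `R_{0m}(u - ξ_m)` over `m` in a list. -/
def listMonodromy (ω η : ℂ) (ξ : Fin N → ℂ) (u : ℂ) (l : List (Fin N)) :
    Matrix (Fin 2) (Fin 2) (QOp N) :=
  (l.map fun m => R0 ω η m (u - ξ m)).prod

theorem monodromy_eq (ω η : ℂ) (ξ : Fin N → ℂ) (u : ℂ) :
    monodromy ω η ξ u = listMonodromy ω η ξ u (List.finRange N).reverse := by
  rw [monodromy, listMonodromy, List.ofFn_eq_map, List.map_reverse]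

theorem listMonodromy_cons (ω η : ℂ) (ξ : Fin N → ℂ) (u : ℂ) (n : Fin N) (l : List (Fin N)) :
    listMonodromy ω η ξ u (n :: l) = R0 ω η n (u - ξ n) * listMonodromy ω η ξ u l := by
  rw [listMonodromy, List.map_cons, List.prod_cons, listMonodromy]

theorem listMonodromy_append (ω η : ℂ) (ξ : Fin N → ℂ) (u : ℂ) (l l' : List (Fin N)) :
    listMonodromy ω η ξ u (l ++ l') = listMonodromy ω η ξ u l * listMonodromy ω η ξ u l' := by
  rw [listMonodromy, List.map_append, List.prod_append, listMonodromy, listMonodromy]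

theorem transfer_eq (ω η : ℂ) (ξ : Fin N → ℂ) (x y : Fin 2) (u : ℂ) :
    transfer ω η ξ x y u =
      Matrix.trace ((twist x y).map (algebraMap ℂ (QOp N)) * monodromy ω η ξ u) := rfl

theorem entriesCommute_R0_listMonodromy (ω η : ℂ) (ξ : Fin N → ℂ) (u v : ℂ) {n : Fin N}
    {l : List (Fin N)} (h : n ∉ l) :
    EntriesCommute (R0 ω η n v) (listMonodromy ω η ξ u l) :=
  EntriesCommute.list_prod_right l fun m hm =>
    entriesCommute_R0 ω η (by rintro rfl; exact h hm) _ _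

theorem entriesCommute_permAux_listMonodromy (ω η : ℂ) (ξ : Fin N → ℂ) (u : ℂ) {n : Fin N}
    {l : List (Fin N)} (h : n ∉ l) :
    EntriesCommute (permAux (siteHom n)) (listMonodromy ω η ξ u l) :=
  EntriesCommute.list_prod_right l fun m hm =>
    entriesCommute_permAux_R0 ω η (by rintro rfl; exact h hm) _

theorem cross_listMonodromy_sub (ω η : ℂ) (ξ : Fin N → ℂ) (u : ℂ) {l : List (Fin N)}
    (hl : l.Nodup) : cross (listMonodromy ω η ξ (u - η) l) =
      (l.reverse.map fun m => -R0 ω η m (-(u - ξ m))).prod := by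
  induction l with
  | nil => exact cross_one
  | cons n l ih =>
    rw [List.nodup_cons] at hl
    rw [listMonodromy_cons, (entriesCommute_R0_listMonodromy ω η ξ _ _ hl.1).cross_mul, ih hl.2,
      sub_right_comm, cross_R0_sub]
    simp

theorem EntriesCommute.cross_right {A : Type*} [Ring A] {Z W : Matrix (Fin 2) (Fin 2) A}
    (h : EntriesCommute Z W) : EntriesCommute Z (cross W) := fun i j k l => by
  fin_cases k <;> fin_cases l
  exacts [h i j 1 1, (h i j 0 1).neg_right, (h i j 1 0).neg_right, h i j 0 0]

/-- The product of the quantum determinants of the factors. -/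
theorem listMonodromy_mul_cross (η : ℂ) (ξ : Fin N → ℂ) (u : ℂ) {ω : ℂ} (hω : 0 < ω.im)
    {l : List (Fin N)} (hl : l.Nodup) :
    listMonodromy ω η ξ u l * cross (listMonodromy ω η ξ (u - η) l) =
      (l.map fun m => theta1 (u - ξ m + η) ω * theta1 (u - ξ m - η) ω).prod • 1 := by
  rw [cross_listMonodromy_sub ω η ξ u hl, listMonodromy, list_prod_mul_reverse_prod l]
  intro m _
  -- The sign from crossing is absorbed by the oddness of `θ₁`.
  rw [mul_neg, R0_mul_R0_neg η m _ hω, ← neg_smul, ← mul_neg, ← theta1_neg]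
  congr 3
  ring

theorem prod_map_finRange (f : Fin N → ℂ) : ((List.finRange N).map f).prod = ∏ n, f n := by
  rw [← List.ofFn_eq_map, List.prod_ofFn]

theorem monodromy_mul_cross (η : ℂ) (ξ : Fin N → ℂ) (u : ℂ) {ω : ℂ} (hω : 0 < ω.im) :
    monodromy ω η ξ u * cross (monodromy ω η ξ (u - η)) =
      (fa ω η ξ u * fd ω η ξ (u - η)) • 1 := by
  rw [monodromy_eq, monodromy_eq, listMonodromy_mul_cross η ξ u hω
    (List.nodup_reverse.mpr (List.nodup_finRange N)), List.map_reverse, List.prod_reverse,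
    prod_map_finRange, Finset.prod_mul_distrib, fd, fa, fa]
  congr 2
  refine Finset.prod_congr rfl fun n _ => ?_
  ring_nf

theorem qdet_eq_smul_one (η : ℂ) (ξ : Fin N → ℂ) (u : ℂ) {ω : ℂ} (hω : 0 < ω.im) :
    qdet ω η ξ u = (fa ω η ξ u * fd ω η ξ (u - η)) • (1 : QOp N) := by
  have h := congrFun (congrFun (monodromy_mul_cross η ξ u hω) 0) 0
  simpa [Matrix.mul_apply, Fin.sum_univ_two, cross, ← sub_eq_add_neg, qdet] using h

theorem qdet_eq_smul_one' (η : ℂ) (ξ : Fin N → ℂ) (u : ℂ) {ω : ℂ} (hω : 0 < ω.im) :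
    monodromy ω η ξ u 1 1 * monodromy ω η ξ (u - η) 0 0 -
      monodromy ω η ξ u 1 0 * monodromy ω η ξ (u - η) 0 1 =
        (fa ω η ξ u * fd ω η ξ (u - η)) • (1 : QOp N) := by
  have h := congrFun (congrFun (monodromy_mul_cross η ξ u hω) 1) 1
  rw [← sub_eq_zero] at h ⊢
  rw [← h]
  simp [Matrix.mul_apply, Fin.sum_univ_two, cross]
  abel

/-! ### Quasi-periodicity -/

theorem transfer_add_pi (ω η : ℂ) (ξ : Fin N → ℂ) (x y : Fin 2) (u : ℂ) :
    transfer ω η ξ x y (u + Real.pi) =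
      ((-1 : ℂ) ^ (N + (y : ℕ))) • transfer ω η ξ x y u := by
  rw [transfer_eq, transfer_eq, monodromy_eq, monodromy_eq, listMonodromy]
  have h : ∀ m, R0 ω η m (u + Real.pi - ξ m) = (-1 : ℂ) •
      (sigmaZ.map (algebraMap ℂ (QOp N)) * R0 ω η m (u - ξ m) *
        sigmaZ.map (algebraMap ℂ (QOp N))) := fun m => by
    rw [add_sub_right_comm, R0_add_pi, neg_one_smul]
  simp only [h]
  rw [list_prod_conj _ sigmaZ_mul_sigmaZ (fun _ => (-1 : ℂ)), ← listMonodromy, mul_smul_comm,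
    Matrix.trace_smul, trace_conj (sigmaZ_conj_twist x y), smul_smul]
  simp [pow_add]

theorem prod_shiftFactor (ω η : ℂ) (ξ : Fin N → ℂ) (x : Fin 2) (u : ℂ) :
    (∏ m, shiftFactor ω η (u - ξ m)) * (-1) ^ (x : ℕ) =
      (-exp (-2 * I * u - I * Real.pi * ω)) ^ N *
        exp (2 * I * (∑ k, ξ k - (N : ℂ) / 2 * η + ((x : ℕ) : ℂ) * (Real.pi / 2))) := by
  have h : ∀ m, shiftFactor ω η (u - ξ m) =
      -exp (-2 * I * u - I * Real.pi * ω) * (exp (2 * I * ξ m) * exp (-I * η)) := fun m => by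
    rw [shiftFactor, neg_mul (exp _), neg_mul (exp _), ← exp_add, ← exp_add, ← exp_add]
    ring_nf
  simp only [h, Finset.prod_mul_distrib, Finset.prod_const, Finset.card_univ, Fintype.card_fin]
  -- Writing `-1 = exp (π i)` puts the twist sign `(-1)^x` into the exponent as `x π/2`.
  rw [mul_assoc, ← exp_sum, ← Finset.mul_sum, ← exp_nat_mul, ← exp_add,
    ← exp_pi_mul_I, ← exp_nat_mul, ← exp_add]
  ring_nf

theorem transfer_add_pi_mul (ω η : ℂ) (ξ : Fin N → ℂ) (x y : Fin 2) (u : ℂ) :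
    transfer ω η ξ x y (u + Real.pi * ω) =
      ((-exp (-2 * I * u - I * Real.pi * ω)) ^ N *
        exp (2 * I * (∑ k, ξ k - (N : ℂ) / 2 * η + ((x : ℕ) : ℂ) * (Real.pi / 2)))) •
        transfer ω η ξ x y u := by
  rw [transfer_eq, transfer_eq, monodromy_eq, monodromy_eq, listMonodromy]
  have h : ∀ m, R0 ω η m (u + Real.pi * ω - ξ m) = shiftFactor ω η (u - ξ m) •
      (sigmaX.map (algebraMap ℂ (QOp N)) * R0 ω η m (u - ξ m) *
        sigmaX.map (algebraMap ℂ (QOp N))) := fun m => by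
    rw [add_sub_right_comm, R0_add_pi_mul]
  simp only [h]
  rw [list_prod_conj _ sigmaX_mul_sigmaX (fun m => shiftFactor ω η (u - ξ m)), ← listMonodromy,
    mul_smul_comm, Matrix.trace_smul, trace_conj (sigmaX_conj_twist x y), smul_smul,
    List.map_reverse, List.prod_reverse, prod_map_finRange, prod_shiftFactor]

end Monodromy

/-! ### Inversion and product identities -/

section Inversion

variable {N : ℕ}

/-- The transfer matrix at an inhomogeneity: the auxiliary space is identified with a site. -/
theorem transfer_at (η : ℂ) (ξ : Fin N → ℂ) (x y : Fin 2) {ω : ℂ} (hω : 0 < ω.im) {n : Fin N}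
    {p s : List (Fin N)} (h : List.finRange N = p ++ n :: s) :
    transfer ω η ξ x y (ξ n) = theta1 η ω • substAux (siteHom n)
      (listMonodromy ω η ξ (ξ n) p.reverse * (twist x y).map (algebraMap ℂ (QOp N)) *
        listMonodromy ω η ξ (ξ n) s.reverse) := by
  have hnd := List.nodup_finRange N
  rw [h, List.nodup_append, List.nodup_cons] at hnd
  obtain ⟨-, ⟨hs, -⟩, hd⟩ := hnd
  have hps : EntriesCommute (listMonodromy ω η ξ (ξ n) s.reverse)
      (listMonodromy ω η ξ (ξ n) p.reverse) := by
    refine EntriesCommute.list_prod_right _ fun m hm => ?_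
    refine (entriesCommute_R0_listMonodromy ω η ξ _ _ fun hm' => ?_).symm
    rw [List.mem_reverse] at hm hm'
    exact hd m hm m (by simp [hm']) rfl
  have hsP := (entriesCommute_permAux_listMonodromy ω η ξ (ξ n)
    (mt List.mem_reverse.mp hs)).symm
  have hK := EntriesCommute.map_algebraMap (permAux (siteHom n) *
    listMonodromy ω η ξ (ξ n) p.reverse) (twist x y)
  -- The twist and the factors from `s` commute entrywise with the permutation and the factors from
  -- `p`, so cyclicity moves them to the end.
  rw [transfer_eq, monodromy_eq, h, List.reverse_append, List.reverse_cons, List.append_assoc,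
    List.singleton_append, listMonodromy_append, listMonodromy_cons, sub_self, R0_zero η n hω,
    smul_mul_assoc, mul_smul_comm, mul_smul_comm, Matrix.trace_smul, ← mul_assoc,
    ← (hK.mul_right (hsP.mul_right hps).symm).trace_mul_comm, ← trace_permAux_mul]
  simp only [mul_assoc]

/-- The companion of `transfer_at` for the shifted argument. -/
theorem transfer_at_sub (η : ℂ) (ξ : Fin N → ℂ) (x y : Fin 2) {ω : ℂ} (hω : 0 < ω.im) {n : Fin N}
    {p s : List (Fin N)} (h : List.finRange N = p ++ n :: s) :
    transfer ω η ξ x y (ξ n - η) = -theta1 η ω • substAux (siteHom n)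
      (cross (listMonodromy ω η ξ (ξ n - η) s.reverse) *
        (twist x y).adjugate.map (algebraMap ℂ (QOp N)) *
          cross (listMonodromy ω η ξ (ξ n - η) p.reverse)) := by
  have hnd := List.nodup_finRange N
  rw [h, List.nodup_append, List.nodup_cons] at hnd
  obtain ⟨-, ⟨hs, -⟩, hd⟩ := hnd
  have hp : n ∉ p := fun hn => hd n hn n (by simp) rfl
  have hsp : ∀ m ∈ s, m ∉ n :: p := fun m hm hm' => by
    rcases List.mem_cons.mp hm' with rfl | hm'
    exacts [hs hm, hd m hm' m (by simp [hm]) rfl]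
  have h1 : EntriesCommute (listMonodromy ω η ξ (ξ n - η) s.reverse)
      (listMonodromy ω η ξ (ξ n - η) (n :: p.reverse)) := by
    refine EntriesCommute.symm (EntriesCommute.list_prod_right _ fun m hm => ?_)
    refine (entriesCommute_R0_listMonodromy ω η ξ _ _ fun hm' => ?_).symm
    exact hsp m (List.mem_reverse.mp hm) (by simpa using hm')
  have h2 : EntriesCommute (R0 ω η n (ξ n - η - ξ n))
      (listMonodromy ω η ξ (ξ n - η) p.reverse) :=
    entriesCommute_R0_listMonodromy ω η ξ _ _ (mt List.mem_reverse.mp hp)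
  have hP := (entriesCommute_permAux_listMonodromy ω η ξ (ξ n - η)
    (mt List.mem_reverse.mp hp)).cross_right
  have hps : EntriesCommute (cross (listMonodromy ω η ξ (ξ n - η) p.reverse))
      (cross (listMonodromy ω η ξ (ξ n - η) s.reverse)) := by
    refine EntriesCommute.cross_right (EntriesCommute.symm (EntriesCommute.cross_right ?_))
    intro i j k l
    refine EntriesCommute.list_prod_right _ (fun m hm => ?_) i j k l
    refine (entriesCommute_R0_listMonodromy ω η ξ _ _ fun hm' => ?_).symm
    exact hsp m (List.mem_reverse.mp hm' ) (by simpa using Or.inr (List.mem_reverse.mp hm))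
  -- Crossing turns the factor `R_{0n}(-η)` into `-R_{0n}(0)`, again a multiple of the permutation,
  -- and reverses the others.
  rw [transfer_eq, trace_mul_eq_trace_cross, monodromy_eq, h, List.reverse_append,
    List.reverse_cons, List.append_assoc, List.singleton_append, listMonodromy_append,
    h1.cross_mul, listMonodromy_cons, h2.cross_mul, sub_right_comm, sub_self, cross_R0_sub,
    neg_zero, R0_zero η n hω, ← neg_smul, mul_smul_comm, smul_mul_assoc, smul_mul_assoc,
    Matrix.trace_smul, mul_assoc, mul_assoc,
    (EntriesCommute.mul_right hP.symm (hps.mul_right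
      (EntriesCommute.map_algebraMap _ _))).trace_mul_comm, mul_assoc, trace_permAux_mul]

theorem smul_one_map_algebraMap (c : ℂ) :
    (c • (1 : Matrix (Fin 2) (Fin 2) ℂ)).map (algebraMap ℂ (QOp N)) = c • 1 := by
  rw [map_algebraMap_smul, map_algebraMap_one]

theorem transfer_mul_transfer_sub (η : ℂ) (ξ : Fin N → ℂ) (x y : Fin 2) {ω : ℂ} (hω : 0 < ω.im)
    (n : Fin N) : transfer ω η ξ x y (ξ n) * transfer ω η ξ x y (ξ n - η) =
      ((-1 : ℂ) ^ ((x : ℕ) + (y : ℕ))) • qdet ω η ξ (ξ n) := by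
  obtain ⟨p, s, h⟩ := List.append_of_mem (List.mem_finRange n)
  have hnd := List.nodup_finRange N
  rw [h, List.nodup_append, List.nodup_cons] at hnd
  obtain ⟨hpn, ⟨hs, hsn⟩, hd⟩ := hnd
  have hp : n ∉ p := fun hn => hd n hn n (by simp) rfl
  have hK := EntriesCommute.map_algebraMap (permAux (siteHom n)) (twist x y)
  have hc := ((entriesCommute_permAux_listMonodromy ω η ξ (ξ n)
    (mt List.mem_reverse.mp hp)).mul_right hK).mul_right
    (entriesCommute_permAux_listMonodromy ω η ξ (ξ n) (mt List.mem_reverse.mp hs))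
  have hX := listMonodromy_mul_cross η ξ (ξ n) hω (List.nodup_reverse.mpr hsn)
  have hY := listMonodromy_mul_cross η ξ (ξ n) hω (List.nodup_reverse.mpr hpn)
  have hKK : (twist x y).map (algebraMap ℂ (QOp N)) *
      (twist x y).adjugate.map (algebraMap ℂ (QOp N)) =
      ((-1 : ℂ) ^ ((x : ℕ) + (y : ℕ))) • 1 := by
    rw [← map_algebraMap_mul, twist_mul_adjugate, smul_one_map_algebraMap]
  rw [transfer_at η ξ x y hω h, transfer_at_sub η ξ x y hω h, smul_mul_smul_comm,
    ← substAux_mul _ hc, qdet_eq_smul_one η ξ _ hω, fd, fa, fa, ← Finset.prod_mul_distrib,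
    ← prod_map_finRange, h]
  set X := listMonodromy ω η ξ (ξ n) s.reverse
  set Y := listMonodromy ω η ξ (ξ n) p.reverse
  set X' := cross (listMonodromy ω η ξ (ξ n - η) s.reverse)
  set Y' := cross (listMonodromy ω η ξ (ξ n - η) p.reverse)
  set K := (twist x y).map (algebraMap ℂ (QOp N))
  set K' := (twist x y).adjugate.map (algebraMap ℂ (QOp N))
  -- Three nested cancellations: `X X'` and `Y Y'` by unitarity, `K K'` by the determinant.
  have hprod : Y * K * X * (X' * K' * Y') = Y * (K * (X * X') * K') * Y' := by
    simp only [mul_assoc]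
  rw [hprod, hX, mul_smul_comm, mul_one, smul_mul_assoc, hKK, mul_smul_comm, mul_smul_comm, mul_one,
    smul_mul_assoc, smul_mul_assoc, hY, smul_smul, smul_smul, substAux_smul_one, smul_smul,
    smul_smul]
  congr 1
  simp only [List.map_reverse, List.prod_reverse, List.map_append, List.map_cons,
    List.prod_append, List.prod_cons, sub_self, zero_add]
  -- The factor of the quantum determinant at `m = n` is `θ₁(η) θ₁(-η)`, supplied by the prefactors
  -- of the two transfer matrices.
  have e : ∀ m, ξ n - η - η - ξ m + η = ξ n - ξ m - η := fun m => by ring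
  simp only [e, sub_self, zero_sub, theta1_neg]
  ring

theorem prod_transfer (η : ℂ) (ξ : Fin N → ℂ) (x y : Fin 2) {ω : ℂ} (hω : 0 < ω.im) :
    (List.ofFn fun n : Fin N => transfer ω η ξ x y (ξ n)).prod =
      (∏ n, fa ω η ξ (ξ n)) •
        (List.ofFn fun n : Fin N => siteOp n (twist x y)).prod := by
  -- With the whole list processed no `R` remains, and the product of `t n m` over `m` is `fa` at `ξ
  -- n`.
  have key := list_prod_telescope (List.finRange N) (List.nodup_finRange N)
    (T := fun n => transfer ω η ξ x y (ξ n)) (k := fun n => siteHom n (twist x y))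
    (r := fun n m => siteR ω η n m (ξ n - ξ m)) (t := fun n m => theta1 (ξ n - ξ m + η) ω)
    ?_ ?_ ?_ ?_ (List.finRange N) [] (by simp)
  · simp only [List.reverse_nil, List.map_nil, List.prod_nil, prod_map_finRange] at key
    rw [List.ofFn_eq_map, List.ofFn_eq_map, key]
    simp [fa, siteHom_apply]
  · intro p n s h
    have hnd := List.nodup_finRange N
    rw [h, List.nodup_append, List.nodup_cons] at hnd
    obtain ⟨-, ⟨hs, -⟩, hd⟩ := hnd
    have hp : n ∉ p := fun hn => hd n hn n (by simp) rfl
    have hev : ∀ l : List (Fin N), n ∉ l → substAux (siteHom n)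
        (listMonodromy ω η ξ (ξ n) l.reverse) =
        (l.reverse.map fun m => siteR ω η n m (ξ n - ξ m)).prod := fun l hl =>
      substAux_list_prod _ _ fun m hm => entriesCommute_permAux_R0 ω η
        (by rintro rfl; exact hl (List.mem_reverse.mp hm)) _
    have hY := entriesCommute_permAux_listMonodromy ω η ξ (ξ n) (mt List.mem_reverse.mp hp)
    rw [transfer_at η ξ x y hω h,
      substAux_mul _ (hY.mul_right (EntriesCommute.map_algebraMap _ _)), substAux_mul _ hY,
      hev p hp, hev s hs, substAux_map_algebraMap, sub_self, zero_add]
  · intro i j hij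
    have := siteR_mul_siteR_neg η hij (ξ i - ξ j) hω
    simpa only [neg_sub] using this
  · exact fun i j m _ hi hj => siteR_commute_siteHom ω η hi hj _ _
  · exact fun i j m n _ _ him hin hjm hjn => siteR_commute_siteR ω η him hin hjm hjn _ _

end Inversion

end EightVertex

end

theorem mainTheorem12 (N : ℕ) (ω η : ℂ) (hω : 0 < ω.im) (ξ : Fin N → ℂ) (x y : Fin 2) :
    -- quasi-periodicity
    (∀ u : ℂ, EightVertex.transfer ω η ξ x y (u + Real.pi) =
      ((-1 : ℂ) ^ (N + (y : ℕ))) • EightVertex.transfer ω η ξ x y u) ∧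
    (∀ u : ℂ, EightVertex.transfer ω η ξ x y (u + Real.pi * ω) =
      ((-Complex.exp (-2 * Complex.I * u - Complex.I * Real.pi * ω)) ^ N *
        Complex.exp (2 * Complex.I *
          (∑ k, ξ k - (N : ℂ) / 2 * η + ((x : ℕ) : ℂ) * (Real.pi / 2)))) •
        EightVertex.transfer ω η ξ x y u) ∧
    -- inversion identity
    (∀ n : Fin N,
      EightVertex.transfer ω η ξ x y (ξ n) * EightVertex.transfer ω η ξ x y (ξ n - η) =
        ((-1 : ℂ) ^ ((x : ℕ) + (y : ℕ))) • EightVertex.qdet ω η ξ (ξ n)) ∧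
    -- the three expressions of the quantum determinant agree
    (∀ u : ℂ,
      EightVertex.qdet ω η ξ u =
        (EightVertex.fa ω η ξ u * EightVertex.fd ω η ξ (u - η)) • (1 : EightVertex.QOp N) ∧
      EightVertex.qdet ω η ξ u =
        EightVertex.monodromy ω η ξ u 1 1 * EightVertex.monodromy ω η ξ (u - η) 0 0 -
          EightVertex.monodromy ω η ξ u 1 0 * EightVertex.monodromy ω η ξ (u - η) 0 1) ∧
    -- product identity
    (List.ofFn fun n : Fin N => EightVertex.transfer ω η ξ x y (ξ n)).prod =
      (∏ n, EightVertex.fa ω η ξ (ξ n)) •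
        (List.ofFn fun n : Fin N => EightVertex.siteOp n (EightVertex.twist x y)).prod := by
  refine ⟨EightVertex.transfer_add_pi ω η ξ x y, EightVertex.transfer_add_pi_mul ω η ξ x y,
    EightVertex.transfer_mul_transfer_sub η ξ x y hω, fun u =>
      ⟨EightVertex.qdet_eq_smul_one η ξ u hω, ?_⟩, EightVertex.prod_transfer η ξ x y hω⟩
  rw [EightVertex.qdet_eq_smul_one η ξ u hω, EightVertex.qdet_eq_smul_one' η ξ u hω]
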